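/- Let $g\in\mathbb R^3\setminus\{0\}$, $0<k\le 1$ and $0<\lambda\le\pi$. Define $f_{k,\lambda}:\mathbb R^3\to\mathbb R^3$ by $$f_{k,\lambda}(x)=k\,\min(\mathrm{angle}(x,g),\lambda)\,\frac{x\times g}{\|x\times g\|}\ \text{ if } x\times g\neq 0,\qquad f_{k,\lambda}(x)=0\ \text{ otherwise},$$ and $K(y)=\exp\big((f_{k,\lambda}(y))_\times\big)\in SO(3)$, where $(x)_\times$ is the skew-symmetric matrix with $(x)_\times a=x\times a$. Consider on $SO(3)$ the system with measurements $$R_{n+1}=W_nR_n\Omega_n,\qquad Y_n=R_n^{T}g+V_n+N_n ,$$ and the artificial-horizon filter $$\hat R'_{n+1}=\hat R_n\Omega_n,\qquad \hat R_{n+1}=K(\hat R'_{n+1}Y_{n+1})\,\hat R'_{n+1},$$ where $(\Omega_n)_{n\ge0}$ is an arbitrary deterministic sequence in $SO(3)$. Assume: 1. the $W_n$ are $SO(3)$-valued with a common law $\nu$ for which there are $\varepsilon>0$ and a neighbourhood $U$ of $I_d$ with $\nu(A)\ge\varepsilon\,\mu(A)$ for every measurable $A\subseteq U$, where $\mu$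 is a Haar measure on $SO(3)$; 2. the sums $V_n+N_n$ are $\mathbb R^3$-valued with a common law $\rho$ that is invariant under all rotations (for instance $V_n$ isotropic Gaussian and $N_n$ an independent isotropic outlier noise that vanishes with high probability); 3. the triples $(W_n,V_n,N_n)$, $n\ge0$, are mutually independent, $W_n$ is independent of $(V_n,N_n)$ for each $n$, and the pair $(R_0,\hat R_0)$, whose joint law is arbitrary, is independent of the whole noise sequence. Let $\eta_n=R_n\hat R_n^{-1}$ be the error variable. Then there is a probability measure $\pi$ on $SO(3)$, depending only on $g,k,\lambda,\nu,\rho$ (and not on the law of the initial pair $(R_0,\hat R_0)$ nor on the inputs $\Omega_n$), which is stationary for the error equation, i.e. if $\eta\sim\pi$, $W\sim\nu$ and $e\sim\rho$ are independent and $\eta'=W\eta$, then $\eta'K(\eta'^{-1}g+e)^{-1}\sim\pi$, and such that the law of $\eta_n$ converges to $\pi$ in total variation as $n\to\infty$. -/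

import Mathlib

open MeasureTheory ProbabilityTheory Filter Topology Matrix
open scoped NNReal

/-- Vectors of three-dimensional space, with the Euclidean norm. -/
abbrev Vec3 : Type := EuclideanSpace ℝ (Fin 3)

/-- The rotation group `SO(3)`, as real orthogonal `3 × 3` matrices of determinant one. -/
abbrev SO3 : Type := Matrix.specialOrthogonalGroup (Fin 3) ℝ

namespace SO3

theorem mem_iff (A : Matrix (Fin 3) (Fin 3) ℝ) :
    A ∈ Matrix.specialOrthogonalGroup (Fin 3) ℝ ↔ A * Aᵀ = 1 ∧ A.det = 1 := by
  rw [Matrix.mem_specialOrthogonalGroup_iff, Matrix.mem_orthogonalGroup_iff]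

theorem coe_inv (R : SO3) : ((R⁻¹ : SO3) : Matrix (Fin 3) (Fin 3) ℝ) = (R.1)ᵀ := rfl

instance instIsTopologicalGroup : IsTopologicalGroup SO3 where
  continuous_mul := by
    refine Continuous.subtype_mk ?_ _
    exact (continuous_subtype_val.comp continuous_fst).matrix_mul
      (continuous_subtype_val.comp continuous_snd)
  continuous_inv := by
    refine continuous_induced_rng.2 ?_
    change Continuous fun R : SO3 => (R.1)ᵀ
    exact continuous_subtype_val.matrix_transpose

instance instCompactSpace : CompactSpace SO3 := by
  refine isCompact_iff_compactSpace.1 ?_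
  have hK : IsCompact (Set.pi Set.univ fun _ : Fin 3 => Set.pi Set.univ fun _ : Fin 3 =>
      Set.Icc (-1 : ℝ) 1) :=
    isCompact_univ_pi fun _ => isCompact_univ_pi fun _ => isCompact_Icc
  refine IsCompact.of_isClosed_subset (X := Matrix (Fin 3) (Fin 3) ℝ) hK ?_ ?_
  · have : ((Matrix.specialOrthogonalGroup (Fin 3) ℝ : Set (Matrix (Fin 3) (Fin 3) ℝ)))
        = {A | A * Aᵀ = 1} ∩ {A | A.det = 1} := by
      ext A
      exact mem_iff A
    rw [this]
    refine IsClosed.inter ?_ ?_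
    · exact isClosed_eq (continuous_id.matrix_mul continuous_id.matrix_transpose) continuous_const
    · exact isClosed_eq continuous_id.matrix_det continuous_const
  · intro A hA i _ j _
    have h := congrFun (congrFun ((mem_iff A).1 hA).1 i) i
    simp only [Matrix.mul_apply, Matrix.transpose_apply, Matrix.one_apply_eq] at h
    have h2 : A i j * A i j ≤ 1 := by
      rw [← h]
      exact Finset.single_le_sum (f := fun j => A i j * A i j)
        (fun j _ => mul_self_nonneg _) (Finset.mem_univ j)
    exact abs_le.1 (abs_le_one_iff_mul_self_le_one.2 h2)

/-- `SO(3)` carries its Borel sigma-algebra. -/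
instance instMeasurableSpace : MeasurableSpace SO3 := borel SO3

instance instBorelSpace : BorelSpace SO3 := ⟨rfl⟩

/-- The rotation `R` applied to the vector `v`. -/
def rot (R : SO3) (v : Vec3) : Vec3 := WithLp.toLp 2 (R.1 *ᵥ v.ofLp)

end SO3

namespace ArtificialHorizon

open SO3

/-- The cross product of Euclidean vectors. -/
def cross (x y : Vec3) : Vec3 := WithLp.toLp 2 (crossProduct x.ofLp y.ofLp)

/-- The skew-symmetric matrix `(x)_×` with `(x)_× a = x × a`. -/
def skew (x : Vec3) : Matrix (Fin 3) (Fin 3) ℝ :=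
  !![0, -x 2, x 1;
     x 2, 0, -x 0;
     -x 1, x 0, 0]

theorem skew_mulVec (x a : Vec3) : WithLp.toLp 2 (skew x *ᵥ a.ofLp) = cross x a := by
  ext i
  fin_cases i <;>
    simp [skew, cross, cross_apply, Matrix.mulVec, dotProduct, Fin.sum_univ_three] <;> ring

theorem skew_transpose (x : Vec3) : (skew x)ᵀ = -skew x := by
  ext i j
  fin_cases i <;> fin_cases j <;> simp [skew]

theorem exp_mem_of_skew {A : Matrix (Fin 3) (Fin 3) ℝ} (hA : Aᵀ = -A) :
    NormedSpace.exp A ∈ Matrix.specialOrthogonalGroup (Fin 3) ℝ := by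
  have key : ∀ B : Matrix (Fin 3) (Fin 3) ℝ, Bᵀ = -B →
      NormedSpace.exp B * (NormedSpace.exp B)ᵀ = 1 := by
    intro B hB
    rw [← Matrix.exp_transpose, hB,
      ← Matrix.exp_add_of_commute _ _ (Commute.neg_right (Commute.refl B)), add_neg_cancel,
      NormedSpace.exp_zero]
  refine (mem_iff _).2 ⟨key A hA, ?_⟩
  have hhalf : ((1 / 2 : ℝ) • A)ᵀ = -((1 / 2 : ℝ) • A) := by
    rw [Matrix.transpose_smul, hA, smul_neg]
  have hsplit : NormedSpace.exp A
      = NormedSpace.exp ((1 / 2 : ℝ) • A) * NormedSpace.exp ((1 / 2 : ℝ) • A) := by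
    rw [← Matrix.exp_add_of_commute _ _ (Commute.refl _), ← add_smul]
    norm_num
  have hdet := congrArg Matrix.det (key _ hhalf)
  rw [Matrix.det_mul, Matrix.det_transpose, Matrix.det_one] at hdet
  rw [hsplit, Matrix.det_mul, hdet]

/-- The exponential map `ℝ³ ≅ so(3) → SO(3)`: `expSO3 x` is the matrix exponential of `(x)_×`. -/
noncomputable def expSO3 (x : Vec3) : SO3 :=
  ⟨NormedSpace.exp (skew x), exp_mem_of_skew (skew_transpose x)⟩

open Classical in
/-- The thresholded correction
`f_{k,λ}(x) = k min(angle(x,g), λ) (x × g) / ‖x × g‖` if `x × g ≠ 0`, and `0` otherwise. -/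
noncomputable def correction (g : Vec3) (k lam : ℝ) (x : Vec3) : Vec3 :=
  if cross x g = 0 then 0
  else (k * min (InnerProductGeometry.angle x g) lam) • (‖cross x g‖⁻¹ • cross x g)

/-- The gain function `K(y) = exp(f_{k,λ}(y))`. -/
noncomputable def gain (g : Vec3) (k lam : ℝ) (y : Vec3) : SO3 := expSO3 (correction g k lam y)

/-- The true attitude: `R_{n+1} = W_n R_n Ω_n`, started at `r₀`. -/
def attitude (r₀ : SO3) (w om : ℕ → SO3) : ℕ → SO3
  | 0 => r₀
  | n + 1 => w n * attitude r₀ w om n * om n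

/-- The accelerometer measurements: `Y_n = R_nᵀ g + V_n + N_n`. -/
def measurement (g : Vec3) (R : ℕ → SO3) (v nn : ℕ → Vec3) (n : ℕ) : Vec3 :=
  rot (R n)⁻¹ g + v n + nn n

/-- The filter, fed with the inputs `Ω_n` and the measurements `Y_n`, and started at `s₀`:
`R̂'_{n+1} = R̂_n Ω_n` and `R̂_{n+1} = K(R̂'_{n+1} Y_{n+1}) R̂'_{n+1}`. -/
noncomputable def estimate (g : Vec3) (k lam : ℝ) (s₀ : SO3) (om : ℕ → SO3) (Y : ℕ → Vec3) :
    ℕ → SO3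
  | 0 => s₀
  | n + 1 =>
    gain g k lam (rot (estimate g k lam s₀ om Y n * om n) (Y (n + 1))) *
      (estimate g k lam s₀ om Y n * om n)

/-- The error variable `η_n = R_n R̂_n⁻¹` of the filter. -/
noncomputable def error (g : Vec3) (k lam : ℝ) (r₀ s₀ : SO3) (w om : ℕ → SO3) (v nn : ℕ → Vec3)
    (n : ℕ) : SO3 :=
  attitude r₀ w om n *
    (estimate g k lam s₀ om (measurement g (attitude r₀ w om) v nn) n)⁻¹

/-- One step of the error equation, with process noise `w` and output noise `e`:
`η' = w η`, then `η'` is mapped to `η' K(η'⁻¹ g + e)⁻¹`. -/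
noncomputable def errorStep (g : Vec3) (k lam : ℝ) (x w : SO3) (e : Vec3) : SO3 :=
  (w * x) * (gain g k lam (rot (w * x)⁻¹ g + e))⁻¹

/-- `π` is a stationary distribution of the error equation, for independent noises with laws `ν`
(process noise) and `ρ` (output noise). -/
def IsStationary (g : Vec3) (k lam : ℝ) (ν : Measure SO3) (ρ : Measure Vec3) (π : Measure SO3) :
    Prop :=
  (π.prod (ν.prod ρ)).map (fun p => errorStep g k lam p.1 p.2.1 p.2.2) = π

/-- Diffusivity of the process noise: near the identity, its law dominates a positive multiple of
Haar measure. (The balls around the identity for an invariant distance are a basis of the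
neighbourhoods of the identity.) -/
def IsDiffusive (ν : Measure SO3) : Prop :=
  ∃ ε : ℝ≥0, 0 < ε ∧ ∃ U ∈ 𝓝 (1 : SO3), ∀ A : Set SO3, MeasurableSet A → A ⊆ U →
    ε * (Measure.haar : Measure SO3) A ≤ ν A

/-- Invariance of a law on `ℝ³` under all rotations. -/
def IsIsotropic (ρ : Measure Vec3) : Prop := ∀ Q : SO3, ρ.map (rot Q) = ρ

/-- The total variation distance `sup_A |μ(A) - π(A)|` of two probability measures. -/
noncomputable def tvDist {X : Type*} [MeasurableSpace X] (μ π : Measure X) : ℝ :=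
  ⨆ A : {A : Set X // MeasurableSet A}, |μ.real A - π.real A|

end ArtificialHorizon

/-! The inputs `Ω_n` cancel in `R_{n+1} R̂'_{n+1}⁻¹ = W_n η_n`. They survive only in the rotation
`R̂'_{n+1}` applied to the output noise; this rotation depends on the past alone, and isotropy makes
it invisible in law. Hence the law of `η_n` evolves under one fixed Markov kernel: a noise step `τ`
followed by a correction step `β` (`error_succ`, `map_errorStep_rot`, `indepFun_history`). Doeblin's
theorem then gives the claim, provided some power of `β * τ` has a nonzero minorant independent of
the starting point (`exists_minorant`).

The minorant comes from `ψ`, Haar measure on a small neighbourhood of `1`, which `τ` dominates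
locally from points near `1`. It remains to reach `1` with positive probability from everywhere. An
isotropic noise charges neighbourhoods of some point on the half-line through the true signal, and
such a noise only rescales the measurement, which the gain ignores; so the noise-free correction can
always be followed approximately. That correction strictly increases `⟨x⁻¹ g, g⟩` unless `x⁻¹ g =
±g`. Among rotations fixing `g` it does nothing, but that stabilizer is a connected circle, which
small process noises can follow back to `1` (`mem_of_backward_closed`). The gain is discontinuous in
the direction `-g`; a preliminary noise step leaves that set. Compactness of `SO(3)` finally makes
the number of steps uniform (`exists_uniform_minorant`). -/

/-! ### Doeblin's theorem for Markov kernels with a minorized power. -/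

section Doeblin

variable {X : Type*} [MeasurableSpace X]

theorem MeasureTheory.Measure.real_bind_eq_integral (κ : Kernel X X) [IsMarkovKernel κ]
    (μ : Measure X) {A : Set X} (hA : MeasurableSet A) :
    (μ.bind κ).real A = ∫ x, (κ x).real A ∂μ := by
  rw [Measure.real, Measure.bind_apply hA κ.measurable.aemeasurable]
  exact (integral_toReal (κ.measurable_coe hA).aemeasurable
    (ae_of_all _ fun x => measure_lt_top _ _)).symm

theorem ProbabilityTheory.Kernel.measurable_real (κ : Kernel X X) {A : Set X}
    (hA : MeasurableSet A) : Measurable fun x => (κ x).real A :=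
  (κ.measurable_coe hA).ennreal_toReal

instance ProbabilityTheory.Kernel.isMarkovKernel_pow (κ : Kernel X X) [IsMarkovKernel κ] (n : ℕ) :
    IsMarkovKernel (κ ^ n) := by
  induction n with
  | zero => rw [pow_zero]; exact inferInstanceAs (IsMarkovKernel Kernel.id)
  | succ n ih => rw [pow_succ]; exact inferInstanceAs (IsMarkovKernel ((κ ^ n) ∘ₖ κ))

theorem ProbabilityTheory.Kernel.mul_apply_eq_bind (κ τ : Kernel X X) (x : X) :
    (κ * τ) x = (τ x).bind κ := Kernel.comp_apply κ τ x

theorem MeasureTheory.Measure.bind_bind_kernel (κ τ : Kernel X X) (μ : Measure X) :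
    (μ.bind κ).bind τ = μ.bind (τ * κ : Kernel X X) := Measure.comp_assoc

theorem integral_mem_Icc_of_bounds (μ : Measure X) [IsProbabilityMeasure μ] {f : X → ℝ}
    (hf : Measurable f) {a b : ℝ} (h : ∀ x, f x ∈ Set.Icc a b) : ∫ x, f x ∂μ ∈ Set.Icc a b := by
  have hi : Integrable f μ := Integrable.of_mem_Icc a b hf.aemeasurable (ae_of_all _ h)
  constructor
  · simpa using integral_mono (integrable_const a) hi fun x => (h x).1
  · simpa using integral_mono hi (integrable_const b) fun x => (h x).2

/-- Averaging against a probability measure with a common part `ψ` contracts oscillations. -/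
theorem integral_mem_Icc_of_minorant (μ ψ : Measure X) [IsProbabilityMeasure μ] (hψ : ψ ≤ μ)
    {f : X → ℝ} (hf : Measurable f) {a r : ℝ} (h : ∀ x, f x ∈ Set.Icc a (a + r)) :
    ∫ x, f x ∂μ ∈ Set.Icc (∫ x, f x ∂ψ + (1 - ψ.real Set.univ) * a)
      (∫ x, f x ∂ψ + (1 - ψ.real Set.univ) * a + (1 - ψ.real Set.univ) * r) := by
  have : IsFiniteMeasure ψ := ⟨(hψ Set.univ).trans_lt (measure_lt_top _ _)⟩
  have hi : Integrable f μ := Integrable.of_mem_Icc a (a + r) hf.aemeasurable (ae_of_all _ h)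
  have hi' : Integrable f ψ := hi.mono_measure hψ
  -- Both `f - a` and `a + r - f` are nonnegative, so their integrals against `ψ` are at most those
  -- against `μ`. The resulting bounds mention only `ψ`.
  have h1 := integral_mono_measure (f := fun x => f x - a) hψ
    (ae_of_all _ fun x => sub_nonneg.2 (h x).1) (hi.sub (integrable_const _))
  have h2 := integral_mono_measure (f := fun x => (a + r) - f x) hψ
    (ae_of_all _ fun x => sub_nonneg.2 (h x).2) ((integrable_const _).sub hi)
  rw [integral_sub hi' (integrable_const _), integral_sub hi (integrable_const _)] at h1
  rw [integral_sub (integrable_const _) hi', integral_sub (integrable_const _) hi] at h2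
  simp only [integral_const, smul_eq_mul, probReal_univ] at h1 h2
  constructor <;> nlinarith

/-- Each further step averages the previous function against `κ x` and shrinks its oscillation by
the factor `1 - ψ(X)`. The endpoint `a` is common to all starting points. -/
theorem ProbabilityTheory.Kernel.pow_real_mem_Icc (κ : Kernel X X) [IsMarkovKernel κ]
    (ψ : Measure X) (hψ : ∀ x, ψ ≤ κ x) {A : Set X} (hA : MeasurableSet A) (n : ℕ) :
    ∃ a, ∀ x, ((κ ^ n) x).real A ∈ Set.Icc a (a + (1 - ψ.real Set.univ) ^ n) := by
  induction n with
  | zero =>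
    refine ⟨0, fun x => ⟨measureReal_nonneg, ?_⟩⟩
    rw [zero_add, pow_zero (1 - ψ.real Set.univ)]
    exact measureReal_le_one (μ := (κ ^ 0) x)
  | succ n ih =>
    obtain ⟨a, ha⟩ := ih
    refine ⟨∫ x, ((κ ^ n) x).real A ∂ψ + (1 - ψ.real Set.univ) * a, fun x => ?_⟩
    rw [pow_succ κ, Kernel.mul_apply_eq_bind, Measure.real_bind_eq_integral _ _ hA,
      pow_succ' (1 - ψ.real Set.univ)]
    exact integral_mem_Icc_of_minorant (κ x) ψ (hψ x) ((κ ^ n).measurable_real hA) ha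

theorem ProbabilityTheory.Kernel.exists_rate_of_minorant (κ : Kernel X X) [IsMarkovKernel κ]
    {m : ℕ} (hm : m ≠ 0) (ψ : Measure X) (hψ0 : ψ ≠ 0) (hψ : ∀ x, ψ ≤ (κ ^ m) x) [Nonempty X] :
    ∃ r : ℕ → ℝ, Tendsto r atTop (𝓝 0) ∧ ∀ n A, MeasurableSet A →
      ∃ a, ∀ x, ((κ ^ n) x).real A ∈ Set.Icc a (a + r n) := by
  obtain ⟨x₀⟩ := ‹Nonempty X›
  have : IsFiniteMeasure ψ := ⟨(hψ x₀ Set.univ).trans_lt (measure_lt_top _ _)⟩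
  have : NeZero ψ := ⟨hψ0⟩
  have hpos : 0 < ψ.real Set.univ := measureReal_univ_pos
  have hle : ψ.real Set.univ ≤ 1 := by
    rw [← probReal_univ (μ := (κ ^ m) x₀)]
    exact ENNReal.toReal_mono (measure_ne_top _ _) (hψ x₀ Set.univ)
  refine ⟨fun n => (1 - ψ.real Set.univ) ^ (n / m), ?_, fun n A hA => ?_⟩
  · exact (tendsto_pow_atTop_nhds_zero_of_lt_one (by linarith) (by linarith)).comp
      (Nat.tendsto_div_const_atTop hm)
  · obtain ⟨a, ha⟩ := (κ ^ m).pow_real_mem_Icc ψ hψ hA (n / m)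
    refine ⟨a, fun x => ?_⟩
    -- The leftover `n % m` steps are taken first; averaging cannot enlarge the interval.
    have hn : κ ^ n = (κ ^ m) ^ (n / m) * κ ^ (n % m) := by
      rw [← pow_mul, ← _root_.pow_add, Nat.div_add_mod]
    rw [hn, Kernel.mul_apply_eq_bind, Measure.real_bind_eq_integral _ _ hA]
    exact integral_mem_Icc_of_bounds _ (Kernel.measurable_real _ hA) ha

/-- A sequence of probability measures that is Cauchy in total variation converges. -/
theorem exists_probabilityMeasure_of_uniform_cauchy (μ : ℕ → Measure X)
    [∀ n, IsProbabilityMeasure (μ n)] (r : ℕ → ℝ) (hr : Tendsto r atTop (𝓝 0))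
    (h : ∀ A, MeasurableSet A → ∀ n k, n ≤ k → |(μ n).real A - (μ k).real A| ≤ r n) :
    ∃ π : Measure X, IsProbabilityMeasure π ∧
      ∀ A, MeasurableSet A → ∀ n, |(μ n).real A - π.real A| ≤ r n := by
  have hlim : ∀ A, MeasurableSet A → ∃ l, Tendsto (fun n => (μ n).real A) atTop (𝓝 l) := by
    intro A hA
    refine cauchySeq_tendsto_of_complete (cauchySeq_of_le_tendsto_0' r (fun n k hnk => ?_) hr)
    rw [Real.dist_eq]
    exact h A hA n k hnk
  choose! l hl using hlim
  have hl0 : ∀ A, MeasurableSet A → 0 ≤ l A := fun A hA =>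
    ge_of_tendsto' (hl A hA) fun n => measureReal_nonneg
  have hlr : ∀ A, MeasurableSet A → ∀ n, |(μ n).real A - l A| ≤ r n := by
    intro A hA n
    refine le_of_tendsto ((tendsto_const_nhds.sub (hl A hA)).abs) ?_
    filter_upwards [eventually_ge_atTop n] with k hk using h A hA n k hk
  have hempty : l ∅ = 0 :=
    tendsto_nhds_unique (hl ∅ MeasurableSet.empty) (by simp)
  have hsum : ∀ f : ℕ → Set X, (∀ i, MeasurableSet (f i)) → Pairwise (Function.onFun Disjoint f) →
      HasSum (fun i => l (f i)) (l (⋃ i, f i)) := by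
    intro f hf hd
    have hadd : ∀ N, ∑ i ∈ Finset.range N, l (f i) = l (⋃ i ∈ Finset.range N, f i) := by
      intro N
      refine tendsto_nhds_unique (tendsto_finsetSum _ fun i _ => hl (f i) (hf i)) ?_
      refine (hl _ (Finset.measurableSet_biUnion _ fun i _ => hf i)).congr fun n => ?_
      exact measureReal_biUnion_finset (fun i _ j _ hij => hd hij) fun i _ => hf i
    rw [hasSum_iff_tendsto_nat_of_nonneg fun i => hl0 _ (hf i)]
    simp_rw [hadd]
    rw [Metric.tendsto_atTop]
    intro ε hε
    -- A single `μ n` is within `ε / 3` of the limit on all measurable sets at once, so its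
    -- countable additivity passes to `l`.
    obtain ⟨n, hn⟩ := ((tendsto_order.1 hr).2 (ε / 3) (by positivity)).exists
    have hμ : Tendsto (fun N => (μ n).real (⋃ i ∈ Finset.range N, f i)) atTop
        (𝓝 ((μ n).real (⋃ i, f i))) := by
      have hs : HasSum (fun i => (μ n).real (f i)) ((μ n).real (⋃ i, f i)) := by
        rw [Measure.real, measure_iUnion hd hf, ENNReal.tsum_toReal_eq fun i => measure_ne_top _ _]
        refine (ENNReal.summable_toReal ?_).hasSum
        rw [← measure_iUnion hd hf]
        exact measure_ne_top _ _
      refine hs.tendsto_sum_nat.congr fun N => ?_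
      exact (measureReal_biUnion_finset (fun i _ j _ hij => hd hij) fun i _ => hf i).symm
    obtain ⟨N, hN⟩ := Metric.tendsto_atTop.1 hμ (ε / 3) (by positivity)
    refine ⟨N, fun k hk => ?_⟩
    have h1 := hN k hk
    have h2 := hlr (⋃ i ∈ Finset.range k, f i)
      (Finset.measurableSet_biUnion _ fun i _ => hf i) n
    have h3 := hlr (⋃ i, f i) (MeasurableSet.iUnion hf) n
    rw [Real.dist_eq] at h1 ⊢
    rw [abs_lt] at h1 ⊢
    rw [abs_le] at h2 h3
    constructor <;> linarith
  let π : Measure X := Measure.ofMeasurable (fun A _ => ENNReal.ofReal (l A)) (by simp [hempty])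
    (fun f hf hd => by
      rw [← (hsum f hf hd).tsum_eq, ENNReal.ofReal_tsum_of_nonneg (fun i => hl0 _ (hf i))
        (hsum f hf hd).summable])
  have hπ : ∀ A, MeasurableSet A → π A = ENNReal.ofReal (l A) := fun A hA =>
    Measure.ofMeasurable_apply A hA
  refine ⟨π, ⟨?_⟩, fun A hA n => ?_⟩
  · rw [hπ _ MeasurableSet.univ, ENNReal.ofReal_eq_one]
    exact tendsto_nhds_unique (hl _ MeasurableSet.univ) (by simp)
  · rw [Measure.real.eq_1 π, hπ A hA, ENNReal.toReal_ofReal (hl0 A hA)]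
    exact hlr A hA n

/-- Layer-cake formula: for values in `[0, 1]`, the integral is the average over `t ∈ [0, 1]` of the
measures of the superlevel sets. -/
theorem abs_integral_sub_integral_le (μ π : Measure X) [IsProbabilityMeasure μ]
    [IsProbabilityMeasure π] {r : ℝ} (h : ∀ A, MeasurableSet A → |μ.real A - π.real A| ≤ r)
    {f : X → ℝ} (hf : Measurable f) (hf01 : ∀ x, f x ∈ Set.Icc (0 : ℝ) 1) :
    |∫ x, f x ∂μ - ∫ x, f x ∂π| ≤ r := by
  have key : ∀ μ : Measure X, IsProbabilityMeasure μ →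
      ∫ x, f x ∂μ = ∫ t in (0 : ℝ)..1, μ.real {x | t ≤ f x} := by
    intro μ hμ
    rw [intervalIntegral.integral_of_le zero_le_one]
    exact (Integrable.of_mem_Icc 0 1 hf.aemeasurable (ae_of_all _ hf01)).integral_eq_integral_Ioc_meas_le
      (ae_of_all _ fun x => (hf01 x).1) (ae_of_all _ fun x => (hf01 x).2)
  have hint : ∀ μ : Measure X, IsProbabilityMeasure μ →
      IntervalIntegrable (fun t => μ.real {x | t ≤ f x}) volume 0 1 := fun μ hμ =>
    Antitone.intervalIntegrable fun s t hst => measureReal_mono fun x hx => hst.trans hx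
  rw [key μ ‹_›, key π ‹_›, ← intervalIntegral.integral_sub (hint μ ‹_›) (hint π ‹_›),
    ← Real.norm_eq_abs]
  refine (intervalIntegral.norm_integral_le_of_norm_le_const fun t _ => ?_).trans
    (by simp : r * |(1 : ℝ) - 0| ≤ r)
  exact h _ (measurableSet_le measurable_const hf)

/-- **Doeblin's theorem.** If some power of a Markov kernel has a uniform nonzero minorant, it has
a stationary law, to which all its iterates converge uniformly in total variation. -/
theorem ProbabilityTheory.Kernel.exists_stationary_of_minorant (κ : Kernel X X) [IsMarkovKernel κ]
    {m : ℕ} (hm : m ≠ 0) (ψ : Measure X) (hψ0 : ψ ≠ 0) (hψ : ∀ x, ψ ≤ (κ ^ m) x) [Nonempty X] :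
    ∃ π : Measure X, IsProbabilityMeasure π ∧ π.bind κ = π ∧
      ∃ r : ℕ → ℝ, Tendsto r atTop (𝓝 0) ∧ ∀ μ : Measure X, IsProbabilityMeasure μ →
        ∀ n A, MeasurableSet A → |(μ.bind (κ ^ n : Kernel X X)).real A - π.real A| ≤ r n := by
  obtain ⟨r, hr, hrate⟩ := κ.exists_rate_of_minorant hm ψ hψ0 hψ
  have hmem : ∀ n A, MeasurableSet A → ∃ a, ∀ μ : Measure X, IsProbabilityMeasure μ →
      (μ.bind (κ ^ n : Kernel X X)).real A ∈ Set.Icc a (a + r n) := by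
    intro n A hA
    obtain ⟨a, ha⟩ := hrate n A hA
    refine ⟨a, fun μ hμ => ?_⟩
    rw [Measure.real_bind_eq_integral _ _ hA]
    exact integral_mem_Icc_of_bounds _ (Kernel.measurable_real _ hA) ha
  have hclose : ∀ (n : ℕ) (A : Set X), MeasurableSet A → ∀ μ τ : Measure X,
      IsProbabilityMeasure μ → IsProbabilityMeasure τ →
      |(μ.bind (κ ^ n : Kernel X X)).real A - (τ.bind (κ ^ n : Kernel X X)).real A| ≤ r n := by
    intro n A hA μ τ hμ hτ
    obtain ⟨a, ha⟩ := hmem n A hA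
    have h1 := ha μ hμ
    have h2 := ha τ hτ
    rw [abs_le]
    constructor <;> linarith [h1.1, h1.2, h2.1, h2.2]
  obtain ⟨x₀⟩ := ‹Nonempty X›
  let ξ : ℕ → Measure X := fun n => (Measure.dirac x₀).bind (κ ^ n : Kernel X X)
  have hξ : ∀ n, IsProbabilityMeasure (ξ n) := fun n => by
    dsimp only [ξ]
    infer_instance
  have hcauchy : ∀ A, MeasurableSet A → ∀ n k, n ≤ k → |(ξ n).real A - (ξ k).real A| ≤ r n := by
    intro A hA n k hnk
    -- Both `ξ k` and `ξ n` are images under `κ ^ n` of some initial law.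
    have hk : ξ k = ((Measure.dirac x₀).bind (κ ^ (k - n) : Kernel X X)).bind
        (κ ^ n : Kernel X X) := by
      rw [Measure.bind_bind_kernel, ← _root_.pow_add, Nat.add_sub_of_le hnk]
    rw [hk]
    exact hclose n A hA _ _ inferInstance inferInstance
  obtain ⟨π, hπ, hconv⟩ := exists_probabilityMeasure_of_uniform_cauchy ξ r hr hcauchy
  have hstat : π.bind κ = π := by
    have hp : IsProbabilityMeasure (π.bind κ) := inferInstance
    refine Measure.ext fun A hA => ?_
    suffices hreal : (π.bind κ).real A = π.real A from
      (measureReal_eq_measureReal_iff).1 hreal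
    -- Compare through `ξ (n + 1)`, the image of `ξ n` under `κ`.
    have hb : ∀ n, |(π.bind κ).real A - π.real A| ≤ r n + r (n + 1) := by
      intro n
      have h1 := abs_integral_sub_integral_le (ξ n) π (fun A hA => hconv A hA n)
        (κ.measurable_real hA) fun x => ⟨measureReal_nonneg, measureReal_le_one⟩
      rw [← Measure.real_bind_eq_integral _ _ hA, ← Measure.real_bind_eq_integral _ _ hA,
        Measure.bind_bind_kernel, ← pow_succ'] at h1
      have h2 := hconv A hA (n + 1)
      rw [abs_le] at h1 h2 ⊢
      constructor <;> linarith [h1.1, h1.2, h2.1, h2.2]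
    have hlim : Tendsto (fun n => r n + r (n + 1)) atTop (𝓝 0) := by
      simpa using hr.add ((tendsto_add_atTop_iff_nat 1).2 hr)
    exact sub_eq_zero.1 (abs_nonpos_iff.1 (ge_of_tendsto' hlim hb))
  have hfix : ∀ n, π.bind (κ ^ n : Kernel X X) = π := by
    intro n
    induction n with
    | zero => rw [pow_zero]; exact Measure.id_comp
    | succ n ih => rw [pow_succ, ← Measure.bind_bind_kernel, hstat, ih]
  refine ⟨π, hπ, hstat, r, hr, fun μ hμ n A hA => ?_⟩
  have := hclose n A hA μ π hμ hπ
  rwa [hfix n] at this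

end Doeblin

/-! ### The action of `SO(3)` on vectors: transitivity on spheres and connected stabilizers. -/

namespace SO3

instance instSecondCountableTopology : SecondCountableTopology SO3 :=
  haveI : SecondCountableTopology (Matrix (Fin 3) (Fin 3) ℝ) :=
    inferInstanceAs (SecondCountableTopology (Fin 3 → Fin 3 → ℝ))
  TopologicalSpace.Subtype.secondCountableTopology _

theorem rot_mul (A B : SO3) (v : Vec3) : rot (A * B) v = rot A (rot B v) := by
  simp [rot, Matrix.mulVec_mulVec]

@[simp]
theorem rot_one (v : Vec3) : rot 1 v = v := by
  simp [rot]

theorem rot_add (A : SO3) (v w : Vec3) : rot A (v + w) = rot A v + rot A w := by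
  simp [rot, Matrix.mulVec_add]

@[simp]
theorem rot_inv_rot (A : SO3) (v : Vec3) : rot A⁻¹ (rot A v) = v := by
  rw [← rot_mul, inv_mul_cancel, rot_one]

@[simp]
theorem rot_rot_inv (A : SO3) (v : Vec3) : rot A (rot A⁻¹ v) = v := by
  rw [← rot_mul, mul_inv_cancel, rot_one]

theorem inner_rot (A : SO3) (v w : Vec3) : inner ℝ (rot A v) (rot A w) = inner ℝ v w := by
  have h : (A.1)ᵀ * A.1 = 1 := congrArg Subtype.val (inv_mul_cancel A)
  simp only [EuclideanSpace.inner_eq_star_dotProduct, rot, star_trivial]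
  rw [Matrix.dotProduct_mulVec, Matrix.vecMul_mulVec, h, Matrix.vecMul_one]

@[simp]
theorem norm_rot (A : SO3) (v : Vec3) : ‖rot A v‖ = ‖v‖ := by
  rw [norm_eq_sqrt_real_inner, inner_rot, ← norm_eq_sqrt_real_inner]

theorem continuous_rot : Continuous fun p : SO3 × Vec3 => rot p.1 p.2 := by
  refine (PiLp.continuous_toLp 2 _).comp ?_
  exact (continuous_subtype_val.comp continuous_fst).matrix_mulVec
    ((PiLp.continuous_ofLp 2 _).comp continuous_snd)

theorem _root_.Continuous.rot {X : Type*} [TopologicalSpace X] {f : X → SO3} {h : X → Vec3}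
    (hf : Continuous f) (hh : Continuous h) : Continuous fun x => SO3.rot (f x) (h x) :=
  continuous_rot.comp (hf.prodMk hh)

theorem inner_eq (v w : Vec3) : inner ℝ v w = v 0 * w 0 + v 1 * w 1 + v 2 * w 2 := by
  simp [PiLp.inner_apply, Fin.sum_univ_three, mul_comm]

theorem inner_self_pos {w : Vec3} (hw : w ≠ 0) : 0 < w 0 * w 0 + w 1 * w 1 + w 2 * w 2 := by
  rw [← inner_eq]
  exact real_inner_self_pos.2 hw

/-- The rotation by the angle `π` about a nonzero vector. -/
noncomputable def halfTurn (w : Vec3) (hw : w ≠ 0) : SO3 :=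
  ⟨(2 / (w 0 * w 0 + w 1 * w 1 + w 2 * w 2)) • Matrix.vecMulVec w.ofLp w.ofLp - 1, by
    have h := div_mul_cancel₀ 2 (inner_self_pos hw).ne'
    generalize 2 / (w 0 * w 0 + w 1 * w 1 + w 2 * w 2) = c at h
    refine (mem_iff _).2 ⟨?_, ?_⟩
    · ext i j
      fin_cases i <;> fin_cases j <;>
        simp [Matrix.mul_apply, Fin.sum_univ_three, Matrix.vecMulVec_apply] <;>
        first
        | linear_combination (c * w 0 * w 0) * h
        | linear_combination (c * w 0 * w 1) * h
        | linear_combination (c * w 0 * w 2) * h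
        | linear_combination (c * w 1 * w 1) * h
        | linear_combination (c * w 1 * w 2) * h
        | linear_combination (c * w 2 * w 2) * h
    · simp [Matrix.det_fin_three, Matrix.vecMulVec_apply]
      linear_combination h⟩

theorem rot_halfTurn (w : Vec3) (hw : w ≠ 0) (v : Vec3) :
    rot (halfTurn w hw) v = (2 * inner ℝ w v / inner ℝ w w) • w - v := by
  rw [inner_eq, inner_eq]
  have h := (inner_self_pos hw).ne'
  ext i
  fin_cases i <;>
    simp [rot, halfTurn, Matrix.mulVec, dotProduct, Fin.sum_univ_three, Matrix.vecMulVec_apply] <;>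
    field_simp <;> ring

theorem exists_ne_zero_inner_eq_zero (u : Vec3) : ∃ w : Vec3, w ≠ 0 ∧ inner ℝ w u = 0 := by
  by_cases h : u 0 = 0 ∧ u 1 = 0
  · refine ⟨!₂[1, 0, 0], fun h0 => ?_, ?_⟩
    · simpa using congrArg (fun v : Vec3 => v 0) h0
    · simp [inner_eq, h.1]
  · refine ⟨!₂[-u 1, u 0, 0], fun h0 => h ?_, ?_⟩
    · have h1 := congrArg (fun v : Vec3 => v 0) h0
      have h2 := congrArg (fun v : Vec3 => v 1) h0
      simp at h1 h2
      exact ⟨h2, h1⟩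
    · simp [inner_eq]
      ring

/-- `SO(3)` acts transitively on every sphere. -/
theorem exists_rot_eq {u v : Vec3} (h : ‖u‖ = ‖v‖) : ∃ Q : SO3, rot Q u = v := by
  -- The half-turn about the bisector `u + v` exchanges `u` and `v`; when `v = -u`, a half-turn
  -- about an axis orthogonal to `u` works.
  by_cases hw : u + v = 0
  · obtain ⟨w, hw0, hwu⟩ := exists_ne_zero_inner_eq_zero u
    refine ⟨halfTurn w hw0, ?_⟩
    rw [rot_halfTurn, hwu, eq_neg_of_add_eq_zero_right hw]
    simp
  · refine ⟨halfTurn (u + v) hw, ?_⟩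
    rw [rot_halfTurn]
    have h1 : 2 * inner ℝ (u + v) u = inner ℝ (u + v) (u + v) := by
      have : inner ℝ u u = inner ℝ v v := by
        rw [real_inner_self_eq_norm_sq, real_inner_self_eq_norm_sq, h]
      simp only [inner_add_left, inner_add_right, real_inner_comm v u]
      linarith [real_inner_comm v u]
    rw [h1, div_self (real_inner_self_pos.2 hw).ne', one_smul, add_sub_cancel_left]

/-- The rotation by the angle `t` about the third axis. -/
noncomputable def rotZ (t : ℝ) : SO3 :=
  ⟨!![Real.cos t, -Real.sin t, 0; Real.sin t, Real.cos t, 0; 0, 0, 1], by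
    refine (mem_iff _).2 ⟨?_, ?_⟩
    · have := Real.sin_sq_add_cos_sq t
      ext i j
      fin_cases i <;> fin_cases j <;>
        simp [Matrix.mul_apply, Fin.sum_univ_three] <;> nlinarith
    · have := Real.sin_sq_add_cos_sq t
      simp [Matrix.det_fin_three]
      nlinarith⟩

theorem continuous_rotZ : Continuous rotZ := by
  refine Continuous.subtype_mk ?_ _
  refine continuous_matrix fun i j => ?_
  fin_cases i <;> fin_cases j <;> simp <;> fun_prop

/-- Orthonormality of the rows forces the last row to be `(0, 0, 1)`. The remaining planar block is
orthogonal of determinant one, and its first column, read as a complex number, has the angle as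
argument. -/
theorem exists_rotZ_eq {R : SO3} (h : rot R !₂[0, 0, 1] = !₂[0, 0, 1]) : ∃ t, rotZ t = R := by
  obtain ⟨M, hM⟩ := R
  obtain ⟨hM1, hM2⟩ := (mem_iff M).1 hM
  have c0 := congrArg (fun v : Vec3 => v 0) h
  have c1 := congrArg (fun v : Vec3 => v 1) h
  have c2 := congrArg (fun v : Vec3 => v 2) h
  simp [rot, Matrix.mulVec, dotProduct, Fin.sum_univ_three] at c0 c1 c2
  have e00 := congrFun (congrFun hM1 0) 0
  have e01 := congrFun (congrFun hM1 0) 1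
  have e11 := congrFun (congrFun hM1 1) 1
  have e22 := congrFun (congrFun hM1 2) 2
  simp [Matrix.mul_apply, Fin.sum_univ_three, c0, c1, c2] at e00 e01 e11 e22
  have r0 : M 2 0 = 0 := by nlinarith [mul_self_nonneg (M 2 0), mul_self_nonneg (M 2 1)]
  have r1 : M 2 1 = 0 := by nlinarith [mul_self_nonneg (M 2 0), mul_self_nonneg (M 2 1)]
  simp [Matrix.det_fin_three, c0, c1, c2, r0, r1] at hM2
  have d : M 1 1 = M 0 0 := by linear_combination M 0 0 * e11 - M 1 1 * hM2 - M 1 0 * e01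
  have e : M 0 1 = -M 1 0 := by linear_combination M 1 1 * e01 - M 0 1 * e11 - M 1 0 * hM2
  have hn : ‖(⟨M 0 0, M 1 0⟩ : ℂ)‖ = 1 := by
    rw [← sq_eq_sq₀ (norm_nonneg _) zero_le_one, ← Complex.normSq_eq_norm_sq, Complex.normSq_mk]
    rw [e] at e00
    linarith
  have hc := Complex.norm_mul_cos_arg ⟨M 0 0, M 1 0⟩
  have hs := Complex.norm_mul_sin_arg ⟨M 0 0, M 1 0⟩
  rw [hn, one_mul] at hc hs
  refine ⟨Complex.arg ⟨M 0 0, M 1 0⟩, Subtype.ext ?_⟩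
  ext i j
  fin_cases i <;> fin_cases j <;> simp [rotZ, hc, hs, c0, c1, c2, r0, r1, d, e]

theorem rotZ_rot (t : ℝ) : rot (rotZ t) !₂[0, 0, 1] = !₂[0, 0, 1] := by
  ext i
  fin_cases i <;> simp [rot, rotZ]

theorem rot_smul (A : SO3) (c : ℝ) (v : Vec3) : rot A (c • v) = c • rot A v := by
  simp [rot, Matrix.mulVec_smul]

/-- The rotations about a given axis form a connected set. -/
theorem isPreconnected_stabilizer {g : Vec3} (hg : g ≠ 0) :
    IsPreconnected {R : SO3 | rot R g = g} := by
  obtain ⟨Q, hQ⟩ : ∃ Q : SO3, rot Q !₂[0, 0, 1] = ‖g‖⁻¹ • g := by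
    refine exists_rot_eq ?_
    rw [norm_smul, norm_inv, norm_norm, inv_mul_cancel₀ (norm_ne_zero_iff.2 hg)]
    simp [EuclideanSpace.norm_eq, Fin.sum_univ_three]
  -- Conjugating by `Q` moves the axis to the third coordinate axis, so the stabilizer is a
  -- continuous image of the line.
  have hset : {R : SO3 | rot R g = g} = Set.range fun t => Q * rotZ t * Q⁻¹ := by
    ext R
    have hg' : g = ‖g‖ • rot Q !₂[0, 0, 1] := by
      rw [hQ, smul_smul, mul_inv_cancel₀ (norm_ne_zero_iff.2 hg), one_smul]
    constructor
    · intro hR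
      have hR' : rot (Q⁻¹ * R * Q) !₂[0, 0, 1] = !₂[0, 0, 1] := by
        have : rot R (‖g‖⁻¹ • g) = ‖g‖⁻¹ • g := by rw [rot_smul, hR]
        rw [rot_mul, rot_mul, hQ, this, ← hQ, rot_inv_rot]
      obtain ⟨t, ht⟩ := exists_rotZ_eq hR'
      exact ⟨t, by simp only [ht]; group⟩
    · rintro ⟨t, rfl⟩
      change rot _ g = g
      rw [hg', rot_smul, rot_mul, rot_mul, rot_inv_rot, rotZ_rot]
  rw [hset]
  exact isPreconnected_range ((continuous_const.mul continuous_rotZ).mul continuous_const)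

end SO3

/-! ### Cross products, Rodrigues' formula, and the regularity and monotonicity of the gain. -/

namespace ArtificialHorizon

open SO3 InnerProductGeometry

@[simp] theorem cross_zero (x y : Vec3) : cross x y 0 = x 1 * y 2 - x 2 * y 1 := by
  simp [cross, cross_apply]

@[simp] theorem cross_one (x y : Vec3) : cross x y 1 = x 2 * y 0 - x 0 * y 2 := by
  simp [cross, cross_apply]

@[simp] theorem cross_two (x y : Vec3) : cross x y 2 = x 0 * y 1 - x 1 * y 0 := by
  simp [cross, cross_apply]

theorem cross_smul_left (c : ℝ) (x y : Vec3) : cross (c • x) y = c • cross x y := by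
  ext i
  fin_cases i <;> simp <;> ring

@[simp] theorem cross_self (x : Vec3) : cross x x = 0 := by
  ext i
  fin_cases i <;> simp <;> ring

theorem inner_cross_self_left (x y : Vec3) : inner ℝ (cross x y) x = 0 := by
  simp [inner_eq]
  ring

theorem cross_cross_self (n y : Vec3) :
    cross n (cross n y) = inner ℝ n y • n - inner ℝ n n • y := by
  simp only [inner_eq]
  ext i
  fin_cases i <;> simp <;> ring

theorem inner_cross_cross (y g : Vec3) :
    inner ℝ (cross (cross y g) y) g = inner ℝ (cross y g) (cross y g) := by
  simp only [inner_eq, cross_zero, cross_one, cross_two]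
  ring

theorem norm_cross_eq (x y : Vec3) : ‖cross x y‖ = Real.sin (angle x y) * (‖x‖ * ‖y‖) := by
  rw [sin_angle_mul_norm_mul_norm, norm_eq_sqrt_real_inner]
  congr 1
  simp only [inner_eq, cross_zero, cross_one, cross_two]
  ring

theorem continuous_cross (g : Vec3) : Continuous fun x : Vec3 => cross x g := by
  refine (PiLp.continuous_toLp 2 _).comp (continuous_pi fun i => ?_)
  fin_cases i <;> simp [cross_apply] <;> fun_prop

theorem continuous_skew : Continuous skew := by
  refine continuous_matrix fun i j => ?_
  fin_cases i <;> fin_cases j <;> simp [skew] <;> fun_prop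

section Exponential

attribute [local instance] Matrix.linftyOpNormedRing Matrix.linftyOpNormedAlgebra

theorem continuous_matrix_exp :
    Continuous (NormedSpace.exp : Matrix (Fin 3) (Fin 3) ℝ → Matrix (Fin 3) (Fin 3) ℝ) :=
  letI : NormedAlgebra ℚ (Matrix (Fin 3) (Fin 3) ℝ) := NormedAlgebra.restrictScalars ℚ ℝ _
  NormedSpace.exp_continuous

/-- **Rodrigues' formula** for a matrix with `A³ = -A`. -/
theorem exp_smul_of_cube_eq_neg {A : Matrix (Fin 3) (Fin 3) ℝ} (hA : A * (A * A) = -A) (t : ℝ) :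
    NormedSpace.exp (t • A) = 1 + Real.sin t • A + (1 - Real.cos t) • (A * A) := by
  -- The right-hand side solves `E' = A E`, so `exp(-tA) E(t)` has zero derivative and keeps its
  -- value `1` at `t = 0`.
  let E : ℝ → Matrix (Fin 3) (Fin 3) ℝ := fun t =>
    1 + Real.sin t • A + (1 - Real.cos t) • (A * A)
  have hE : ∀ t, HasDerivAt E (A * E t) t := by
    intro t
    have h1 := ((Real.hasDerivAt_sin t).smul_const A).const_add 1
    have h2 := ((Real.hasDerivAt_cos t).const_sub 1).smul_const (A * A)
    refine (h1.add h2).congr_deriv ?_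
    simp only [E, mul_add, Matrix.mul_smul, hA, mul_one, neg_neg]
    module
  have hF : ∀ t, HasDerivAt (fun t => NormedSpace.exp (t • (-A)) * E t) 0 t := by
    intro t
    refine ((hasDerivAt_exp_smul_const (-A) t).mul (hE t)).congr_deriv ?_
    noncomm_ring
  have hconst := is_const_of_deriv_eq_zero (fun t => (hF t).differentiableAt)
    (fun t => (hF t).deriv) t 0
  have h0 : NormedSpace.exp ((0 : ℝ) • (-A)) * E 0 = 1 := by simp [E]
  rw [h0] at hconst
  have hinv : NormedSpace.exp (t • A) * NormedSpace.exp (t • (-A)) = 1 := by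
    rw [← Matrix.exp_add_of_commute _ _ (by
      rw [smul_neg]; exact Commute.neg_right (Commute.refl _)), smul_neg, add_neg_cancel,
      NormedSpace.exp_zero]
  calc NormedSpace.exp (t • A) = NormedSpace.exp (t • A) * (NormedSpace.exp (t • (-A)) * E t) := by
        rw [hconst, mul_one]
    _ = E t := by rw [← mul_assoc, hinv, one_mul]

end Exponential

theorem continuous_expSO3 : Continuous expSO3 :=
  Continuous.subtype_mk (continuous_matrix_exp.comp continuous_skew) _

@[simp] theorem expSO3_zero : expSO3 0 = 1 := by
  refine Subtype.ext ?_
  have : skew 0 = 0 := by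
    ext i j
    fin_cases i <;> fin_cases j <;> simp [skew]
  simp [expSO3, this]

theorem skew_smul (t : ℝ) (n : Vec3) : skew (t • n) = t • skew n := by
  ext i j
  fin_cases i <;> fin_cases j <;> simp [skew]

theorem skew_cube {n : Vec3} (hn : inner ℝ n n = (1 : ℝ)) :
    skew n * (skew n * skew n) = -skew n := by
  have h : skew n * (skew n * skew n) = (-inner ℝ n n : ℝ) • skew n := by
    simp only [inner_eq]
    ext i j
    fin_cases i <;> fin_cases j <;>
      simp [skew, Matrix.mul_apply, Fin.sum_univ_three] <;> ring
  rw [h, hn, neg_one_smul]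

theorem rot_expSO3_smul {n : Vec3} (hn : inner ℝ n n = (1 : ℝ)) {y : Vec3}
    (hy : inner ℝ n y = (0 : ℝ)) (t : ℝ) :
    rot (expSO3 (t • n)) y = Real.cos t • y + Real.sin t • cross n y := by
  have h : rot (expSO3 (t • n)) y
      = y + Real.sin t • cross n y + (1 - Real.cos t) • cross n (cross n y) := by
    simp only [rot, expSO3, skew_smul]
    rw [exp_smul_of_cube_eq_neg (skew_cube hn), ← skew_mulVec n (cross n y), ← skew_mulVec n y]
    simp [Matrix.add_mulVec, Matrix.smul_mulVec, Matrix.mulVec_mulVec]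
  rw [h, cross_cross_self, hn, hy]
  module

/-- Below the full angle, the correction brings `y` closer to `g`. -/
theorem inner_lt_inner_rot_expSO3 {y g : Vec3} (hc : cross y g ≠ 0) {t : ℝ} (ht : 0 < t)
    (ht' : t ≤ angle y g) :
    inner ℝ y g < inner ℝ (rot (expSO3 (t • (‖cross y g‖⁻¹ • cross y g))) y) g := by
  have hc' : ‖cross y g‖ ≠ 0 := norm_ne_zero_iff.2 hc
  have hcpos : 0 < ‖cross y g‖ := norm_pos_iff.2 hc
  rw [rot_expSO3_smul, inner_add_left, inner_smul_left, inner_smul_left, cross_smul_left,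
    inner_smul_left, inner_cross_cross, real_inner_self_eq_norm_sq, ← cos_angle_mul_norm_mul_norm]
  · have hs := norm_cross_eq y g
    have hyg : 0 < ‖y‖ * ‖g‖ := by
      refine lt_of_le_of_ne (by positivity) fun h0 => hc' ?_
      rw [hs, ← h0, mul_zero]
    have e : ‖cross y g‖⁻¹ * ‖cross y g‖ ^ 2 = ‖cross y g‖ := by field_simp
    simp only [conj_trivial]
    rw [e, hs]
    -- The rotated vector has inner product `‖y‖ ‖g‖ cos (angle y g - t)` with `g`, since it turns
    -- towards `g` in the plane of `y` and `g`.
    have hcos : Real.cos (angle y g) < Real.cos (angle y g - t) :=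
      Real.cos_lt_cos_of_nonneg_of_le_pi (by linarith) (angle_le_pi y g) (by linarith)
    rw [Real.cos_sub] at hcos
    nlinarith
  · rw [inner_smul_left, inner_smul_right, real_inner_self_eq_norm_sq]
    simp only [conj_trivial]
    field_simp
  · rw [inner_smul_left, inner_cross_self_left, mul_zero]

section Gain

variable {g : Vec3} {k lam : ℝ}

theorem correction_smul {s : ℝ} (hs : 0 < s) (y : Vec3) :
    correction g k lam (s • y) = correction g k lam y := by
  unfold correction
  rw [cross_smul_left, angle_smul_left_of_pos _ _ hs, norm_smul, Real.norm_of_nonneg hs.le,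
    mul_inv, smul_smul (_ * _) s, mul_right_comm, inv_mul_cancel₀ hs.ne', one_mul]
  simp [hs.ne']

theorem gain_smul {s : ℝ} (hs : 0 < s) (y : Vec3) : gain g k lam (s • y) = gain g k lam y := by
  rw [gain, correction_smul hs, gain]

theorem correction_of_cross_eq_zero {y : Vec3} (h : cross y g = 0) : correction g k lam y = 0 := by
  simp [correction, h]

theorem gain_of_cross_eq_zero {y : Vec3} (h : cross y g = 0) : gain g k lam y = 1 := by
  rw [gain, correction_of_cross_eq_zero h, expSO3_zero]

/-- This gives continuity in the direction of `g`, where the unit axis has no limit but the angle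
tends to zero. -/
theorem norm_correction_le (hk : 0 < k) (hlam : 0 < lam) (y : Vec3) :
    ‖correction g k lam y‖ ≤ k * angle y g := by
  unfold correction
  have h0 := angle_nonneg y g
  split_ifs with h
  · rw [norm_zero]
    positivity
  · rw [norm_smul, norm_smul, norm_inv, norm_norm, inv_mul_cancel₀ (norm_ne_zero_iff.2 h), mul_one,
      Real.norm_of_nonneg (by positivity)]
    exact mul_le_mul_of_nonneg_left (min_le_left _ _) hk.le

theorem measurable_gain : Measurable (gain g k lam) := by
  refine continuous_expSO3.measurable.comp ?_
  unfold correction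
  have hcr := (continuous_cross g).measurable
  refine Measurable.ite (hcr (measurableSet_singleton 0)) measurable_const ?_
  have hang : Measurable fun x : Vec3 => angle x g := by
    unfold angle
    refine Real.continuous_arccos.measurable.comp (Measurable.div ?_ ?_)
    · exact (continuous_id.inner continuous_const).measurable
    · exact (continuous_norm.mul continuous_const).measurable
  exact ((hang.min measurable_const).const_mul k).smul (hcr.norm.inv.smul hcr)

theorem continuousAt_angle_left {y g : Vec3} (hy : y ≠ 0) (hg : g ≠ 0) :
    ContinuousAt (fun y => angle y g) y :=
  ContinuousAt.comp (f := fun y : Vec3 => (y, g)) (continuousAt_angle (x := (y, g)) hy hg)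
    (by fun_prop)

theorem continuousAt_gain_of_cross_ne_zero {y : Vec3} (h : cross y g ≠ 0) :
    ContinuousAt (gain g k lam) y := by
  refine continuous_expSO3.continuousAt.comp ?_
  have hy : y ≠ 0 := by
    rintro rfl
    exact h (by simpa using cross_smul_left 0 0 g)
  have hg : g ≠ 0 := by
    rintro rfl
    exact h (by ext i; fin_cases i <;> simp)
  have hcr := (continuous_cross g).continuousAt (x := y)
  have hev : ∀ᶠ x in 𝓝 y, cross x g ≠ 0 := hcr.eventually_ne h
  have hcont : ContinuousAt (fun x => (k * min (angle x g) lam) • (‖cross x g‖⁻¹ • cross x g)) y :=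
    (continuousAt_const.mul ((continuousAt_angle_left hy hg).min continuousAt_const)).smul
      ((hcr.norm.inv₀ (norm_ne_zero_iff.2 h)).smul hcr)
  refine hcont.congr ?_
  filter_upwards [hev] with x hx
  simp [correction, hx]

theorem continuousAt_gain_of_pos_smul (hk : 0 < k) (hlam : 0 < lam) (hg : g ≠ 0) {s : ℝ}
    (hs : 0 < s) : ContinuousAt (gain g k lam) (s • g) := by
  refine continuous_expSO3.continuousAt.comp ?_
  have hang : ContinuousAt (fun y => k * angle y g) (s • g) :=
    continuousAt_const.mul (continuousAt_angle_left (smul_ne_zero hs.ne' hg) hg)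
  have h0 : cross (s • g) g = 0 := by rw [cross_smul_left, cross_self, smul_zero]
  rw [ContinuousAt, correction_of_cross_eq_zero h0]
  rw [ContinuousAt, angle_smul_left_of_pos _ _ hs, angle_self hg, mul_zero] at hang
  exact squeeze_zero_norm (norm_correction_le hk hlam) hang

theorem eq_or_eq_neg_of_cross_eq_zero {y : Vec3} (hg : g ≠ 0) (hn : ‖y‖ = ‖g‖)
    (h : cross y g = 0) : y = g ∨ y = -g := by
  have hs := norm_cross_eq y g
  have hgn : ‖g‖ ≠ 0 := norm_ne_zero_iff.2 hg
  have hy : y ≠ 0 := norm_ne_zero_iff.1 (hn ▸ hgn)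
  rw [h, norm_zero, eq_comm, mul_eq_zero, or_iff_left (by rw [hn]; positivity),
    sin_eq_zero_iff_angle_eq_zero_or_angle_eq_pi] at hs
  rcases hs with hs | hs
  · obtain ⟨-, r, hr, e⟩ := angle_eq_zero_iff.1 hs
    left
    have : ‖g‖ = r * ‖y‖ := by rw [e, norm_smul, Real.norm_of_nonneg hr.le]
    have : r = 1 := by
      rw [hn] at this
      field_simp at this
      linarith
    rw [e, this, one_smul]
  · obtain ⟨-, r, hr, e⟩ := angle_eq_pi_iff.1 hs
    right
    have : ‖g‖ = -r * ‖y‖ := by rw [e, norm_smul, Real.norm_of_nonpos hr.le]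
    have : r = -1 := by
      rw [hn] at this
      field_simp at this
      linarith
    rw [e, this, neg_one_smul, neg_neg]

/-- The direction `-g` is excluded: near it the angle is close to `π` while the axis takes every
direction orthogonal to `g`. -/
theorem continuousAt_gain_smul (hk : 0 < k) (hlam : 0 < lam) (hg : g ≠ 0) {y : Vec3}
    (hn : ‖y‖ = ‖g‖) (hy : y ≠ -g) {s : ℝ} (hs : 0 < s) :
    ContinuousAt (gain g k lam) (s • y) := by
  by_cases h : cross y g = 0
  · rw [(eq_or_eq_neg_of_cross_eq_zero hg hn h).resolve_right hy]
    exact continuousAt_gain_of_pos_smul hk hlam hg hs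
  · refine continuousAt_gain_of_cross_ne_zero ?_
    rw [cross_smul_left]
    exact smul_ne_zero hs.ne' h

theorem inner_lt_inner_rot_gain (hk : 0 < k) (hk1 : k ≤ 1) (hlam : 0 < lam) {y : Vec3}
    (hc : cross y g ≠ 0) : inner ℝ y g < inner ℝ (rot (gain g k lam y) y) g := by
  have hang : 0 < angle y g := by
    refine lt_of_le_of_ne (angle_nonneg _ _) fun h => hc ?_
    rw [← norm_eq_zero, norm_cross_eq, ← h, Real.sin_zero, zero_mul]
  rw [gain, correction, if_neg hc]
  refine inner_lt_inner_rot_expSO3 hc (mul_pos hk (lt_min hang hlam)) ?_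
  -- The bound `k ≤ 1` prevents overshooting `g`.
  calc k * min (angle y g) lam ≤ 1 * angle y g :=
        mul_le_mul hk1 (min_le_left _ _) (le_min hang.le hlam.le) zero_le_one
    _ = angle y g := one_mul _

end Gain

end ArtificialHorizon

/-- A right translate of Haar measure is left invariant, hence a multiple of it; equality of the
finite nonzero total masses makes the factor `1`. -/
theorem MeasureTheory.Measure.haar_isMulRightInvariant_of_compactSpace {G : Type*} [Group G]
    [TopologicalSpace G] [IsTopologicalGroup G] [CompactSpace G] [MeasurableSpace G]
    [BorelSpace G] : (Measure.haar : Measure G).IsMulRightInvariant := by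
  refine ⟨fun g => ?_⟩
  have h := Measure.isMulInvariant_eq_smul_of_compactSpace
    ((Measure.haar : Measure G).map (· * g)) Measure.haar
  set c := Measure.haarScalarFactor ((Measure.haar : Measure G).map (· * g)) Measure.haar
  have huniv := congrArg (fun μ : Measure G => μ Set.univ) h
  simp only [Measure.map_apply (measurable_mul_const g) MeasurableSet.univ, Set.preimage_univ,
    Measure.smul_apply] at huniv
  have hc : c = 1 := by
    have h1 : (1 : ENNReal) * (Measure.haar : Measure G) Set.univ
        = (c : ENNReal) * (Measure.haar : Measure G) Set.univ := by
      rw [one_mul]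
      exact huniv
    have h2 := (ENNReal.mul_left_inj
      (isOpen_univ.measure_ne_zero (Measure.haar : Measure G) Set.univ_nonempty)
      (measure_ne_top _ _)).1 h1
    exact_mod_cast h2.symm
  rw [h, hc, one_smul]

/-! ### Kernels driven by a random input, and local minorization. -/

section Kernels

variable {X Y Z E : Type*} [MeasurableSpace X] [MeasurableSpace Y] [MeasurableSpace Z]
  [MeasurableSpace E]

/-- The Markov kernel `x ↦ law of f (x, e)`, where `e` has law `ρ`. -/
noncomputable def randomMap (f : X × E → Y) (ρ : Measure E) : Kernel X Y :=
  (Kernel.id ×ₖ Kernel.const X ρ).map f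

theorem randomMap_apply {f : X × E → Y} (hf : Measurable f) (ρ : Measure E) [SFinite ρ] (x : X) :
    randomMap f ρ x = ρ.map fun e => f (x, e) := by
  rw [randomMap, Kernel.map_apply _ hf, Kernel.prod_apply, Kernel.id_apply, Kernel.const_apply,
    Measure.dirac_prod, Measure.map_map hf (by fun_prop)]
  rfl

theorem isMarkovKernel_randomMap {f : X × E → Y} (hf : Measurable f) (ρ : Measure E)
    [IsProbabilityMeasure ρ] : IsMarkovKernel (randomMap f ρ) :=
  Kernel.IsMarkovKernel.map _ hf

theorem bind_randomMap {f : X × E → Y} (hf : Measurable f) (ρ : Measure E) [SFinite ρ]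
    (μ : Measure X) [SFinite μ] : μ.bind (randomMap f ρ) = (μ.prod ρ).map f := by
  refine Measure.ext fun A hA => ?_
  rw [Measure.bind_apply hA (Kernel.aemeasurable _), Measure.map_apply hf hA,
    Measure.prod_apply (hf hA)]
  refine lintegral_congr fun x => ?_
  rw [randomMap_apply hf, Measure.map_apply (by fun_prop) hA]
  rfl

theorem smul_le_bind (κ : Kernel X Y) {ψ : Measure Y} {N : Set X} (hN : MeasurableSet N)
    {c : ENNReal} (h : ∀ z ∈ N, c • ψ ≤ κ z) (μ : Measure X) :
    (c * μ N) • ψ ≤ μ.bind κ := by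
  refine Measure.le_iff.2 fun A hA => ?_
  rw [Measure.bind_apply hA (Kernel.aemeasurable _), Measure.smul_apply, smul_eq_mul]
  calc c * μ N * ψ A = ∫⁻ _ in N, c * ψ A ∂μ := by
        rw [setLIntegral_const]
        ring
    _ ≤ ∫⁻ z in N, κ z A ∂μ := setLIntegral_mono' hN fun z hz => Measure.le_iff.1 (h z hz) A hA
    _ ≤ ∫⁻ z, κ z A ∂μ := setLIntegral_le_lintegral _ _

/-- Near `x`, the kernel `κ` dominates a fixed positive multiple of `ψ`. -/
def LocallyMinorized [TopologicalSpace X] (ψ : Measure Y) (κ : Kernel X Y) (x : X) : Prop :=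
  ∃ c : ENNReal, c ≠ 0 ∧ ∀ᶠ x' in 𝓝 x, c • ψ ≤ κ x'

theorem LocallyMinorized.eventually [TopologicalSpace X] {ψ : Measure Y} {κ : Kernel X Y} {x : X}
    (h : LocallyMinorized ψ κ x) : ∀ᶠ x' in 𝓝 x, LocallyMinorized ψ κ x' := by
  obtain ⟨c, hc, h⟩ := h
  exact h.eventually_nhds.mono fun x' hx' => ⟨c, hc, hx'⟩

/-- Composition with a random map which, from points near `x`, reaches every neighbourhood of `q`
with a probability that is bounded below. -/
theorem LocallyMinorized.comp_randomMap [TopologicalSpace X] [TopologicalSpace Y]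
    [OpensMeasurableSpace Y] [TopologicalSpace E] [OpensMeasurableSpace E]
    {ψ : Measure Z} {κ : Kernel Y Z} {f : X × E → Y} (hf : Measurable f) {ρ : Measure E} [SFinite ρ]
    {x : X} {e : E} (hfe : ContinuousAt f (x, e)) (he : ∀ N ∈ 𝓝 e, ρ N ≠ 0)
    (h : LocallyMinorized ψ κ (f (x, e))) : LocallyMinorized ψ (κ ∘ₖ randomMap f ρ) x := by
  obtain ⟨c, hc, h⟩ := h
  obtain ⟨M, hM, hMo, hxM⟩ := eventually_nhds_iff.1 h
  -- Continuity at the single point `(x, e)` suffices, which allows for the discontinuities of the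
  -- gain.
  have hev : ∀ᶠ p in 𝓝 (x, e), f p ∈ M := hfe.eventually (hMo.mem_nhds hxM)
  rw [nhds_prod_eq] at hev
  obtain ⟨px, hpx, pe, hpe, hp⟩ := eventually_prod_iff.1 hev
  refine ⟨c * ρ {e | pe e}, mul_ne_zero hc (he _ hpe), ?_⟩
  filter_upwards [hpx] with x' hx'
  rw [Kernel.comp_apply]
  refine le_trans ?_ (smul_le_bind κ hMo.measurableSet hM _)
  have hle : ρ {e | pe e} ≤ randomMap f ρ x' M := by
    rw [randomMap_apply hf, Measure.map_apply (by fun_prop) hMo.measurableSet]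
    exact measure_mono fun e' he' => hp hx' he'
  refine Measure.le_iff.2 fun A _ => ?_
  simp only [Measure.smul_apply, smul_eq_mul]
  gcongr

end Kernels

/-! ### The two half-steps of the error chain and the supports of their noises. -/

namespace ArtificialHorizon

open SO3

variable {g : Vec3} {k lam : ℝ}

/-- The correction step of the error equation, with output noise `e`. -/
noncomputable def correct (g : Vec3) (k lam : ℝ) (p : SO3 × Vec3) : SO3 :=
  p.1 * (gain g k lam (rot p.1⁻¹ g + p.2))⁻¹

theorem measurable_correct : Measurable (correct g k lam) := by
  have h1 : Continuous fun p : SO3 × Vec3 => rot p.1⁻¹ g + p.2 :=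
    (Continuous.rot continuous_fst.inv continuous_const).add continuous_snd
  exact measurable_fst.mul (measurable_gain.comp h1.measurable).inv

theorem measurable_rightMul : Measurable fun p : SO3 × SO3 => p.2 * p.1 :=
  (continuous_snd.mul continuous_fst).measurable

theorem continuousAt_correct {p : SO3 × Vec3}
    (h : ContinuousAt (gain g k lam) (rot p.1⁻¹ g + p.2)) :
    ContinuousAt (correct g k lam) p := by
  have h1 : Continuous fun p : SO3 × Vec3 => rot p.1⁻¹ g + p.2 :=
    (Continuous.rot continuous_fst.inv continuous_const).add continuous_snd
  exact continuousAt_fst.mul (ContinuousAt.comp (f := fun p : SO3 × Vec3 => rot p.1⁻¹ g + p.2)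
    h h1.continuousAt).inv

/-- Noise along the true signal only rescales the measurement, and the gain depends only on
direction. -/
theorem correct_smul (x : SO3) {s : ℝ} (hs : 0 ≤ s) :
    correct g k lam (x, s • rot x⁻¹ g) = correct g k lam (x, 0) := by
  have h : rot x⁻¹ g + s • rot x⁻¹ g = (1 + s) • rot x⁻¹ g := by rw [add_smul, one_smul]
  simp only [correct, h, add_zero]
  rw [gain_smul (by positivity)]

/-- An isotropic law charges the neighbourhoods of some point of every half-line. -/
theorem IsIsotropic.exists_support {ρ : Measure Vec3} [IsProbabilityMeasure ρ]
    (hρ : IsIsotropic ρ) {y : Vec3} (hy : y ≠ 0) :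
    ∃ s : ℝ, 0 ≤ s ∧ ∀ N ∈ 𝓝 (s • y), ρ N ≠ 0 := by
  obtain ⟨e, -, he⟩ := exists_mem_forall_mem_nhdsWithin_pos_measure
    (μ := ρ) (s := Set.univ) (by simp)
  rw [nhdsWithin_univ] at he
  have hy' : ‖y‖ ≠ 0 := norm_ne_zero_iff.2 hy
  -- A point `e` of the support is rotated onto the half-line; isotropy keeps it in the support. The
  -- case `e = 0` gives `s = 0`.
  obtain ⟨Q, hQ⟩ : ∃ Q : SO3, rot Q e = (‖e‖ / ‖y‖) • y := by
    refine exists_rot_eq ?_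
    rw [norm_smul, Real.norm_of_nonneg (by positivity), div_mul_cancel₀ _ hy']
  refine ⟨‖e‖ / ‖y‖, by positivity, fun N hN => ?_⟩
  have hc : Continuous (rot Q) := Continuous.rot continuous_const continuous_id
  rw [← hQ] at hN
  have h1 : 0 < ρ (rot Q ⁻¹' N) := he _ (hc.continuousAt hN)
  have h2 := Measure.le_map_apply (μ := ρ) hc.measurable.aemeasurable N
  rw [hρ Q] at h2
  exact (h1.trans_le h2).ne'

theorem IsDiffusive.exists_open {ν : Measure SO3} (hν : IsDiffusive ν) :
    ∃ ε : ENNReal, ε ≠ 0 ∧ ∃ U : Set SO3, IsOpen U ∧ 1 ∈ U ∧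
      ε • (Measure.haar : Measure SO3).restrict U ≤ ν := by
  obtain ⟨ε, hε, U, hU, h⟩ := hν
  refine ⟨ε, by exact_mod_cast hε.ne', interior U, isOpen_interior,
    mem_interior_iff_mem_nhds.2 hU, Measure.le_iff.2 fun A hA => ?_⟩
  rw [Measure.smul_apply, smul_eq_mul, Measure.restrict_apply hA]
  exact (h _ (hA.inter isOpen_interior.measurableSet)
    (Set.inter_subset_right.trans interior_subset)).trans (measure_mono Set.inter_subset_left)

/-- The kernel of the process noise. -/
noncomputable abbrev noiseKernel (ν : Measure SO3) : Kernel SO3 SO3 :=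
  randomMap (fun p : SO3 × SO3 => p.2 * p.1) ν

/-- The kernel of the correction step. -/
noncomputable abbrev correctKernel (g : Vec3) (k lam : ℝ) (ρ : Measure Vec3) : Kernel SO3 SO3 :=
  randomMap (correct g k lam) ρ

/-- By right invariance, the law of `W q` dominates `ε` times Haar measure on `U q`, and one `B`
lies in `U q` for all `q` near `1`. -/
theorem exists_locallyMinorized_noiseKernel {ν : Measure SO3} [IsProbabilityMeasure ν]
    {ε : ENNReal} (hε : ε ≠ 0) {U : Set SO3} (hU : IsOpen U) (h1 : 1 ∈ U)
    (h : ε • (Measure.haar : Measure SO3).restrict U ≤ ν) :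
    ∃ B : Set SO3, IsOpen B ∧ 1 ∈ B ∧
      LocallyMinorized ((Measure.haar : Measure SO3).restrict B) (noiseKernel ν) 1 := by
  have := Measure.haar_isMulRightInvariant_of_compactSpace (G := SO3)
  have hev : ∀ᶠ p in 𝓝 ((1 : SO3), (1 : SO3)), p.1 * p.2⁻¹ ∈ U := by
    have hc : Continuous fun p : SO3 × SO3 => p.1 * p.2⁻¹ := by fun_prop
    exact hc.continuousAt.eventually (hU.mem_nhds (by simpa using h1))
  rw [nhds_prod_eq] at hev
  obtain ⟨pb, hpb, pm, hpm, hp⟩ := eventually_prod_iff.1 hev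
  obtain ⟨B, hB, hBo, hB1⟩ := eventually_nhds_iff.1 hpb
  refine ⟨B, hBo, hB1, ε, hε, ?_⟩
  filter_upwards [hpm] with q hq
  refine Measure.le_iff.2 fun A hA => ?_
  have hA' : MeasurableSet ((· * q) ⁻¹' A) := measurable_mul_const q hA
  rw [randomMap_apply measurable_rightMul, Measure.map_apply (measurable_mul_const q) hA]
  refine le_trans ?_ (Measure.le_iff.1 h _ hA')
  rw [Measure.smul_apply, Measure.smul_apply, Measure.restrict_apply hA,
    Measure.restrict_apply hA', smul_eq_mul, smul_eq_mul]
  gcongr ε * ?_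
  rw [← measure_preimage_mul_right (Measure.haar : Measure SO3) q (A ∩ B)]
  refine measure_mono fun w hw => ⟨hw.1, ?_⟩
  simpa using hp (hB _ hw.2) hq

/-- In every neighbourhood of the identity there is a rotation moving `g`. -/
theorem exists_rot_inv_ne (hg : g ≠ 0) {U : Set SO3} (hU : U ∈ 𝓝 1) (v : Vec3) :
    ∃ u ∈ U, rot u⁻¹ g ≠ v := by
  by_contra! hcon
  have hv : v = g := by simpa using (hcon 1 (mem_of_mem_nhds hU)).symm
  obtain ⟨w, hw0, hwg⟩ := exists_ne_zero_inner_eq_zero g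
  have hw' : ‖w‖ ≠ 0 := norm_ne_zero_iff.2 hw0
  set n : Vec3 := ‖w‖⁻¹ • w
  have hn : inner ℝ n n = (1 : ℝ) := by
    simp only [n, inner_smul_left, inner_smul_right, real_inner_self_eq_norm_sq, conj_trivial]
    field_simp
  have hng : inner ℝ n g = (0 : ℝ) := by simp only [n, inner_smul_left, hwg, mul_zero]
  have hc : Continuous fun t : ℝ => expSO3 (t • n) :=
    continuous_expSO3.comp (continuous_id.smul continuous_const)
  have hev : ∀ᶠ t in 𝓝 (0 : ℝ), expSO3 (t • n) ∈ U :=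
    hc.continuousAt.eventually (by simpa using hU)
  obtain ⟨δ, hδ, hball⟩ := Metric.eventually_nhds_iff.1 hev
  -- A rotation by `t` about `n ⟂ g` multiplies the component along `g` by `cos t`. The bound `δ /
  -- 2` keeps it in `U`, and `1 < π` gives `cos t < 1`.
  set t := min (δ / 2) 1
  have ht : 0 < t := lt_min (by positivity) one_pos
  have htU : expSO3 (t • n) ∈ U := hball (by
    rw [Real.dist_eq, sub_zero, abs_of_pos ht]
    exact (min_le_left _ _).trans_lt (by linarith))
  have hfix : rot (expSO3 (t • n)) g = g := by
    conv_lhs => rw [← hv, ← hcon _ htU, rot_rot_inv]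
  rw [rot_expSO3_smul hn hng] at hfix
  have hin := congrArg (fun v => inner ℝ v g) hfix
  have h0 : inner ℝ (cross n g) g = (0 : ℝ) := by
    simp only [inner_eq, cross_zero, cross_one, cross_two]
    ring
  simp only [inner_add_left, inner_smul_left, h0, conj_trivial, mul_zero, add_zero] at hin
  have hcos : Real.cos t = 1 := by
    have := (real_inner_self_pos.2 hg).ne'
    field_simp at hin
    linarith
  have hlt : Real.cos t < Real.cos 0 := Real.cos_lt_cos_of_nonneg_of_le_pi le_rfl
    ((min_le_right _ _).trans (by linarith [Real.pi_gt_three])) ht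
  rw [Real.cos_zero] at hlt
  linarith

end ArtificialHorizon

/-! ### From local to uniform minorization on a compact space. -/

section Compactness

variable {X Y : Type*} [MeasurableSpace X] [MeasurableSpace Y]

theorem smul_le_bind_of_smul_le (κ : Kernel X Y) {φ : Measure X} {ψ : Measure Y} {N : Set X}
    (hN : MeasurableSet N) {c : ENNReal} (h : ∀ z ∈ N, c • ψ ≤ κ z) {μ : Measure X} {d : ENNReal}
    (hμ : d • φ ≤ μ) : (d * (c * φ N)) • ψ ≤ μ.bind κ := by
  refine le_trans (Measure.le_iff.2 fun A _ => ?_) (smul_le_bind κ hN h μ)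
  have h1 : d * φ N ≤ μ N := Measure.le_iff.1 hμ N hN
  simp only [Measure.smul_apply, smul_eq_mul]
  calc d * (c * φ N) * ψ A = c * (d * φ N) * ψ A := by ring
    _ ≤ c * μ N * ψ A := by gcongr

/-- On a compact space, a minorant `ψ` that is reproduced by `κ` and locally dominated by the
compositions `κ ^ n ∘ τ` is dominated uniformly. -/
theorem exists_uniform_minorant [TopologicalSpace X] [CompactSpace X] {ψ : Measure Y}
    (κ : Kernel Y Y) (τ : Kernel X Y) {N : Set Y} (hN : MeasurableSet N) (hψN : ψ N ≠ 0)
    {c : ENNReal} (hc : c ≠ 0) (hκ : ∀ z ∈ N, c • ψ ≤ κ z)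
    (h : ∀ x, ∃ n, LocallyMinorized ψ ((κ ^ n) ∘ₖ τ) x) :
    ∃ n, ∃ d : ENNReal, d ≠ 0 ∧ ∀ x, d • ψ ≤ ((κ ^ n) ∘ₖ τ) x := by
  -- The image of `ψ` under `κ` dominates `(c * ψ N) • ψ`, so extra steps cost only a nonzero factor
  -- and different exponents can be raised to a common one.
  have hsucc : ∀ m n x, ∀ d : ENNReal, d ≠ 0 → d • ψ ≤ ((κ ^ n) ∘ₖ τ) x →
      (d * (c * ψ N) ^ m) • ψ ≤ ((κ ^ (m + n)) ∘ₖ τ) x := by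
    intro m n x d _ hd
    induction m with
    | zero => simpa using hd
    | succ m ih =>
      have := smul_le_bind_of_smul_le κ hN hκ ih
      rw [← Kernel.comp_apply, ← Kernel.comp_assoc] at this
      rw [pow_succ (c * ψ N), ← mul_assoc, Nat.add_right_comm, pow_succ' κ]
      exact this
  have key : ∃ n, ∃ d : ENNReal, d ≠ 0 ∧ ∀ x ∈ Set.univ, d • ψ ≤ ((κ ^ n) ∘ₖ τ) x := by
    refine isCompact_univ.induction_on
      (p := fun s => ∃ n, ∃ d : ENNReal, d ≠ 0 ∧ ∀ x ∈ s, d • ψ ≤ ((κ ^ n) ∘ₖ τ) x)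
      ⟨0, 1, one_ne_zero, by simp⟩ ?_ ?_ ?_
    · rintro s t hst ⟨n, d, hd, hn⟩
      exact ⟨n, d, hd, fun x hx => hn x (hst hx)⟩
    · rintro s t ⟨n, d, hd, hn⟩ ⟨n', d', hd', hn'⟩
      have hcN : c * ψ N ≠ 0 := mul_ne_zero hc hψN
      refine ⟨n' + n, min (d * (c * ψ N) ^ n') (d' * (c * ψ N) ^ n),
        (lt_min (pos_iff_ne_zero.2 (mul_ne_zero hd (pow_ne_zero _ hcN)))
          (pos_iff_ne_zero.2 (mul_ne_zero hd' (pow_ne_zero _ hcN)))).ne', ?_⟩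
      have hmono : ∀ a b : ENNReal, a ≤ b → a • ψ ≤ b • ψ := fun a b hab =>
        Measure.le_iff.2 fun A _ => mul_le_mul_left hab (ψ A)
      rintro x (hx | hx)
      · exact (hmono _ _ (min_le_left _ _)).trans (hsucc n' n x d hd (hn x hx))
      · rw [add_comm n' n]
        exact (hmono _ _ (min_le_right _ _)).trans (hsucc n n' x d' hd' (hn' x hx))
    · intro x _
      obtain ⟨n, d, hd, hn⟩ := h x
      exact ⟨_, mem_nhdsWithin_of_mem_nhds hn, n, d, hd, fun y hy => hy⟩
  obtain ⟨n, d, hd, h⟩ := key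
  exact ⟨n, d, hd, fun x => h x (Set.mem_univ x)⟩

end Compactness

/-! ### Reachability of the identity and the uniform minorant. -/

namespace ArtificialHorizon

open SO3

variable {g : Vec3} {k lam : ℝ}

theorem ne_neg_self (hg : g ≠ 0) : g ≠ -g := fun h => by
  have h1 := congrArg (inner ℝ g) h
  rw [inner_neg_right] at h1
  linarith [real_inner_self_pos.2 hg]

/-- An open set of rotations which contains `1`, and which contains `x` as soon as it meets the
neighbourhood `U * correct (x, 0)`, contains every `x` for which `x⁻¹ g` is not opposite to `g`. -/
theorem mem_of_backward_closed (hg : g ≠ 0) (hk : 0 < k) (hk1 : k ≤ 1) (hlam : 0 < lam)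
    {U S : Set SO3} (hU : IsOpen U) (h1U : 1 ∈ U) (hS : IsOpen S) (h1S : 1 ∈ S)
    (hback : ∀ x : SO3, rot x⁻¹ g ≠ -g → ∀ u ∈ U, u * correct g k lam (x, 0) ∈ S → x ∈ S)
    {x : SO3} (hx : rot x⁻¹ g ≠ -g) : x ∈ S := by
  by_contra hxS
  have hJ : Continuous fun x : SO3 => inner ℝ (rot x⁻¹ g) g :=
    (Continuous.rot continuous_inv continuous_const).inner continuous_const
  -- Take the point outside `S` best aligned with `g`. It is not opposite to `g`, since that would
  -- be the minimum and force `x` to be opposite too; if not aligned, the correction would move it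
  -- to a better point, hence into `S`.
  obtain ⟨z, hzS, hz⟩ := hS.isClosed_compl.isCompact.exists_isMaxOn ⟨x, hxS⟩ hJ.continuousOn
  have hzg : rot z⁻¹ g ≠ -g := by
    intro h
    have hle : inner ℝ (rot x⁻¹ g) g ≤ inner ℝ (rot z⁻¹ g) g := hz hxS
    rw [h, inner_neg_left, real_inner_self_eq_norm_sq] at hle
    refine hx (eq_neg_of_add_eq_zero_left (norm_eq_zero.1 (sq_eq_zero_iff.1
      (le_antisymm ?_ (sq_nonneg _)))))
    rw [norm_add_sq_real, norm_rot]
    linarith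
  have hfix : rot z⁻¹ g = g := by
    by_contra hne
    have hc : cross (rot z⁻¹ g) g ≠ 0 := fun h0 =>
      (eq_or_eq_neg_of_cross_eq_zero hg (norm_rot _ _) h0).elim hne hzg
    have hlt := inner_lt_inner_rot_gain hk hk1 hlam hc
    have hmem : correct g k lam (z, 0) ∉ S := fun h =>
      hzS (hback z hzg 1 h1U (by rwa [one_mul]))
    have hle : inner ℝ (rot (correct g k lam (z, 0))⁻¹ g) g ≤ inner ℝ (rot z⁻¹ g) g := hz hmem
    simp only [correct, add_zero, _root_.mul_inv_rev, inv_inv, rot_mul] at hle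
    linarith
  have hng : g ≠ -g := ne_neg_self hg
  -- The stabilizer is covered by `S` and the `U`-neighbourhood of its points outside `S`, both open
  -- and both meeting it. A common point `y` is one `U`-step from some `w ∉ S` fixed by the
  -- correction, so `w ∈ S`: a contradiction.
  obtain ⟨y, hy⟩ := isPreconnected_stabilizer hg S
    (⋃ w ∈ Sᶜ ∩ {R : SO3 | rot R g = g}, (· * w⁻¹) ⁻¹' U) hS
    (isOpen_biUnion fun w _ => hU.preimage (continuous_mul_const w⁻¹))
    (fun y hy => by
      by_cases hyS : y ∈ S
      · exact Or.inl hyS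
      · exact Or.inr (Set.mem_biUnion (show y ∈ Sᶜ ∩ {R : SO3 | rot R g = g} from ⟨hyS, hy⟩)
          (by simpa using h1U)))
    ⟨1, rot_one g, h1S⟩
    (by
      have hz' : rot z g = g := by
        conv_lhs => rw [← hfix, rot_rot_inv]
      exact ⟨z, hz', Set.mem_biUnion (show z ∈ Sᶜ ∩ {R : SO3 | rot R g = g} from ⟨hzS, hz'⟩)
        (by simpa using h1U)⟩)
  obtain ⟨-, hyS, hyU⟩ := hy
  obtain ⟨w, ⟨hwS, hwg⟩, hyw⟩ := Set.mem_iUnion₂.1 hyU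
  have hwg' : rot w⁻¹ g = g := by
    conv_lhs => rw [← (show rot w g = g from hwg), rot_inv_rot]
  refine hwS (hback w (by rw [hwg']; exact hng) (y * w⁻¹) hyw ?_)
  have hcw : correct g k lam (w, 0) = w := by
    simp only [correct, add_zero, hwg']
    rw [gain_of_cross_eq_zero (cross_self g), inv_one, mul_one]
  rwa [hcw, inv_mul_cancel_right]

theorem exists_minorant (hg : g ≠ 0) (hk : 0 < k) (hk1 : k ≤ 1) (hlam : 0 < lam)
    {ν : Measure SO3} [IsProbabilityMeasure ν] (hν : IsDiffusive ν)
    {ρ : Measure Vec3} [IsProbabilityMeasure ρ] (hρ : IsIsotropic ρ) :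
    ∃ m : ℕ, m ≠ 0 ∧ ∃ ψ : Measure SO3, ψ ≠ 0 ∧
      ∀ x, ψ ≤ ((correctKernel g k lam ρ * noiseKernel ν : Kernel SO3 SO3) ^ m) x := by
  obtain ⟨ε, hε, U, hU, h1U, hνU⟩ := hν.exists_open
  obtain ⟨B, hB, h1B, hmin⟩ := exists_locallyMinorized_noiseKernel hε hU h1U hνU
  set ψ := (Measure.haar : Measure SO3).restrict B
  have hψ : ∀ V : Set SO3, IsOpen V → 1 ∈ V → ψ V ≠ 0 := by
    intro V hV h1V
    rw [Measure.restrict_apply hV.measurableSet]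
    exact (hV.inter hB).measure_ne_zero _ ⟨1, h1V, h1B⟩
  have hmark : IsMarkovKernel (correctKernel g k lam ρ) :=
    isMarkovKernel_randomMap measurable_correct ρ
  set τ := noiseKernel ν
  set β := correctKernel g k lam ρ
  have hnoise : ∀ (κ : Kernel SO3 SO3) (q u : SO3), u ∈ U → LocallyMinorized ψ κ (u * q) →
      LocallyMinorized ψ (κ ∘ₖ τ) q := by
    intro κ q u hu hκ
    refine LocallyMinorized.comp_randomMap (e := u) measurable_rightMul
      (continuous_snd.mul continuous_fst).continuousAt (fun N hN => ?_) hκ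
    have h1 : 0 < (Measure.haar : Measure SO3) (N ∩ U) :=
      Measure.measure_pos_of_mem_nhds _ (inter_mem hN (hU.mem_nhds hu))
    have h2 := (hνU : ∀ s, _ ≤ _) N
    rw [Measure.smul_apply, Measure.restrict_apply' hU.measurableSet, smul_eq_mul] at h2
    exact ((pos_iff_ne_zero.2 (mul_ne_zero hε h1.ne')).trans_le h2).ne'
  have hcorrect : ∀ (κ : Kernel SO3 SO3) (x : SO3), rot x⁻¹ g ≠ -g →
      LocallyMinorized ψ κ (correct g k lam (x, 0)) → LocallyMinorized ψ (κ ∘ₖ β) x := by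
    intro κ x hx hκ
    obtain ⟨s, hs, hsupp⟩ := hρ.exists_support (y := rot x⁻¹ g)
      (norm_ne_zero_iff.1 (by rwa [norm_rot, norm_ne_zero_iff]))
    refine LocallyMinorized.comp_randomMap (e := s • rot x⁻¹ g) measurable_correct
      (continuousAt_correct ?_) hsupp (by rwa [correct_smul x hs])
    have h : rot x⁻¹ g + s • rot x⁻¹ g = (1 + s) • rot x⁻¹ g := by rw [add_smul, one_smul]
    rw [h]
    exact continuousAt_gain_smul hk hlam hg (norm_rot _ _) hx (by positivity)
  have hng : rot (1 : SO3)⁻¹ g ≠ -g := by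
    rw [inv_one, rot_one]
    exact ne_neg_self hg
  -- This serves twice: it puts `1` in the reachable set, and it gives the neighbourhood on which `τ
  -- * β` reproduces `ψ`.
  have hone : LocallyMinorized ψ (τ ∘ₖ β) 1 := by
    refine hcorrect τ 1 hng ?_
    have : correct g k lam (1, 0) = 1 := by
      simp only [correct, inv_one, rot_one, add_zero]
      rw [gain_of_cross_eq_zero (cross_self g), inv_one, mul_one]
    rwa [this]
  have hmem : ∀ x : SO3, rot x⁻¹ g ≠ -g → ∃ n, LocallyMinorized ψ ((τ * β) ^ n) x := by
    intro x hx
    refine mem_of_backward_closed (S := {x | ∃ n, LocallyMinorized ψ ((τ * β) ^ n) x}) hg hk hk1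
      hlam hU h1U ?_ ⟨1, by rw [pow_one]; exact hone⟩ ?_ hx
    · refine isOpen_iff_eventually.2 fun x hx => ?_
      obtain ⟨n, hn⟩ := hx
      exact hn.eventually.mono fun y hy => ⟨n, hy⟩
    · rintro x hx u hu ⟨n, hn⟩
      refine ⟨n + 1, ?_⟩
      have := hcorrect _ x hx (hnoise _ _ u hu hn)
      rwa [Kernel.comp_assoc] at this
  obtain ⟨c, hc, hcN⟩ := hone
  obtain ⟨N, hN, hNo, h1N⟩ := eventually_nhds_iff.1 hcN
  obtain ⟨n, d, hd, hunif⟩ := exists_uniform_minorant (τ * β) τ hNo.measurableSet (hψ N hNo h1N) hc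
    hN (fun q => by
      -- Starting with a noise step removes the exception: some `u ∈ U` makes `(u * q)⁻¹ g ≠ -g`.
      obtain ⟨u, hu, hne⟩ := exists_rot_inv_ne hg (hU.mem_nhds h1U) (-rot q g)
      obtain ⟨n, hn⟩ := hmem (u * q) (by
        intro h
        refine hne ?_
        rw [_root_.mul_inv_rev, rot_mul] at h
        have h' := congrArg (rot q) h
        rw [rot_rot_inv, ← neg_one_smul ℝ g, rot_smul, neg_one_smul] at h'
        exact h')
      exact ⟨n, hnoise _ _ u hu hn⟩)
  -- The bound is for `(τ * β) ^ n * τ`; a final correction step completes `(β * τ) ^ (n + 1)` and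
  -- turns `ψ` into `ψ.bind β`, of the same mass.
  refine ⟨n + 1, n.succ_ne_zero, d • ψ.bind β, ?_, fun x => ?_⟩
  · intro h0
    have h1 := congrArg (fun μ : Measure SO3 => μ Set.univ) h0
    simp only [Measure.smul_apply, smul_eq_mul, Measure.coe_zero, Pi.zero_apply] at h1
    rw [Measure.bind_apply MeasurableSet.univ (Kernel.aemeasurable _)] at h1
    simp only [measure_univ, lintegral_one] at h1
    exact mul_ne_zero hd (hψ Set.univ isOpen_univ (Set.mem_univ 1)) h1
  · have hpow : (β * τ) ^ (n + 1) = β * ((τ * β) ^ n * τ) := by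
      rw [pow_succ, ← mul_assoc, mul_pow_mul, mul_assoc]
    rw [hpow, Kernel.mul_apply_eq_bind]
    refine Measure.le_iff.2 fun A hA => ?_
    rw [Measure.smul_apply, Measure.bind_apply hA (Kernel.aemeasurable _),
      Measure.bind_apply hA (Kernel.aemeasurable _), ← lintegral_smul_measure]
    exact lintegral_mono' (hunif x) le_rfl

end ArtificialHorizon

/-! ### Independence of the history from the next noises. -/

section Independence

variable {Ω α β γ : Type*} [MeasurableSpace Ω] [MeasurableSpace α] [MeasurableSpace β]
  [MeasurableSpace γ] {P : Measure Ω} [IsProbabilityMeasure P] {X : Ω → α} {Y : Ω → β} {Z : Ω → γ}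

theorem ProbabilityTheory.IndepFun.assoc (hX : Measurable X) (hY : Measurable Y)
    (hZ : Measurable Z) (hXY : IndepFun X Y P) (h : IndepFun (fun ω => (X ω, Y ω)) Z P) :
    IndepFun X (fun ω => (Y ω, Z ω)) P := by
  have hYZ : IndepFun Y Z P := h.comp measurable_snd measurable_id
  rw [indepFun_iff_map_prod_eq_prod_map_map (by fun_prop) (by fun_prop)] at hXY h hYZ ⊢
  have := Measure.isProbabilityMeasure_map (μ := P) hX.aemeasurable
  have := Measure.isProbabilityMeasure_map (μ := P) hY.aemeasurable
  have := Measure.isProbabilityMeasure_map (μ := P) hZ.aemeasurable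
  rw [hYZ, ← Measure.prodAssoc_prod, ← hXY, ← h,
    Measure.map_map MeasurableEquiv.prodAssoc.measurable (by fun_prop)]
  rfl

theorem ProbabilityTheory.IndepFun.assoc_symm (hX : Measurable X) (hY : Measurable Y)
    (hZ : Measurable Z) (hYZ : IndepFun Y Z P) (h : IndepFun X (fun ω => (Y ω, Z ω)) P) :
    IndepFun (fun ω => (X ω, Y ω)) Z P := by
  have h1 : IndepFun (fun ω => (Z ω, Y ω)) X P :=
    (h.comp (φ := id) (ψ := Prod.swap) measurable_id measurable_swap).symm
  have h2 := IndepFun.assoc hZ hY hX hYZ.symm h1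
  exact (h2.comp (φ := id) (ψ := Prod.swap) measurable_id measurable_swap).symm

/-- The history `(X, t₀, …, t_{n-1}, b_n)` is independent of `(a_n, b_{n+1})`, for independent
`t_i = (a_i, b_i)` with independent components. -/
theorem indepFun_history {a : ℕ → Ω → β} {b : ℕ → Ω → γ} (hX : Measurable X)
    (ha : ∀ n, Measurable (a n)) (hb : ∀ n, Measurable (b n))
    (hind : iIndepFun (fun n ω => (a n ω, b n ω)) P) (hab : ∀ n, IndepFun (a n) (b n) P)
    (hXt : IndepFun X (fun ω n => (a n ω, b n ω)) P) (n : ℕ) :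
    IndepFun (fun ω => ((X ω, fun i : Finset.range n => (a i ω, b i ω)), b n ω))
      (fun ω => (a n ω, b (n + 1) ω)) P := by
  let t : ℕ → Ω → β × γ := fun n ω => (a n ω, b n ω)
  have ht : ∀ n, Measurable (t n) := fun n => (ha n).prodMk (hb n)
  have hτ : Measurable fun ω => fun i : Finset.range n => t i ω :=
    measurable_pi_lambda _ fun i => ht i
  have h1 : IndepFun (fun ω => fun i : Finset.range n => t i ω) (t n) P :=
    (hind.indepFun_finset (Finset.range n) {n} (by simp) ht).comp (φ := id)
      (ψ := fun f : ({n} : Finset ℕ) → β × γ => f ⟨n, by simp⟩) measurable_id (measurable_pi_apply _)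
  have h2 : IndepFun (fun ω => (fun i : Finset.range n => t i ω, t n ω)) (t (n + 1)) P := by
    let last : Finset.range (n + 1) := ⟨n, by simp⟩
    let old : Finset.range n → Finset.range (n + 1) := fun i => ⟨i, by
      have := Finset.mem_range.1 i.2
      simp only [Finset.mem_range]
      omega⟩
    have hφ : Measurable fun f : Finset.range (n + 1) → β × γ => (fun i => f (old i), f last) :=
      (measurable_pi_lambda _ fun i => measurable_pi_apply (old i)).prodMk
        (measurable_pi_apply last)
    exact (hind.indepFun_finset (Finset.range (n + 1)) {n + 1} (by simp) ht).comp
      (ψ := fun f : ({n + 1} : Finset ℕ) → β × γ => f ⟨n + 1, by simp⟩) hφ (measurable_pi_apply _)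
  have h3 : IndepFun X (fun ω => ((fun i : Finset.range n => t i ω, t n ω), t (n + 1) ω)) P :=
    hXt.comp (φ := id)
      (ψ := fun f : ℕ → β × γ => ((fun i : Finset.range n => f i, f n), f (n + 1)))
      measurable_id (((measurable_pi_lambda _ fun i => measurable_pi_apply _).prodMk
        (measurable_pi_apply _)).prodMk (measurable_pi_apply _))
  have h4 := IndepFun.assoc_symm hX (hτ.prodMk (ht n)) (ht (n + 1)) h2 h3
  have h5 := IndepFun.assoc_symm hX hτ (ht n) h1
    (h3.comp (φ := id) (ψ := Prod.fst) measurable_id measurable_fst)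
  -- Independence within the pair at time `n` is used here: `b n` joins the history, `a n` the
  -- future.
  have h6 := IndepFun.assoc_symm (hX.prodMk hτ) (hb n) (ha n) (hab n).symm
    (h5.comp (φ := id) (ψ := Prod.swap) measurable_id measurable_swap)
  refine IndepFun.assoc ((hX.prodMk hτ).prodMk (hb n)) (ha n) (hb (n + 1)) h6 ?_
  exact h4.comp
    (φ := fun p : α × ((Finset.range n → β × γ) × (β × γ)) => (((p.1, p.2.1), p.2.2.2), p.2.2.1))
    (ψ := Prod.snd) (by fun_prop) measurable_snd

end Independence

/-! ### The error as a Markov chain. -/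

namespace ArtificialHorizon

open SO3

variable {g : Vec3} {k lam : ℝ}

/-- The attitude and its estimate at time `n` are a measurable function of the history. -/
theorem exists_measurable_state (g : Vec3) (k lam : ℝ) (om : ℕ → SO3) (n : ℕ) :
    ∃ Φ : ((SO3 × SO3) × (Finset.range n → SO3 × Vec3 × Vec3)) × (Vec3 × Vec3) → SO3 × SO3,
      Measurable Φ ∧ ∀ r₀ s₀ w v nn,
        (attitude r₀ w om n, estimate g k lam s₀ om (measurement g (attitude r₀ w om) v nn) n)
          = Φ (((r₀, s₀), fun i => (w i, v i, nn i)), (v n, nn n)) := by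
  induction n with
  | zero => exact ⟨fun p => p.1.1, by fun_prop, fun _ _ _ _ _ => rfl⟩
  | succ n ih =>
    obtain ⟨Φ, hΦ, h⟩ := ih
    let last : Finset.range (n + 1) := ⟨n, by simp⟩
    let old : Finset.range n → Finset.range (n + 1) := fun i => ⟨i, by
      have := Finset.mem_range.1 i.2
      simp only [Finset.mem_range]
      omega⟩
    let Ψ : ((SO3 × SO3) × (Finset.range (n + 1) → SO3 × Vec3 × Vec3)) × (Vec3 × Vec3) →
        SO3 × SO3 := fun p => Φ ((p.1.1, fun i => p.1.2 (old i)), (p.1.2 last).2)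
    have hlast : Measurable fun p : ((SO3 × SO3) × (Finset.range (n + 1) → SO3 × Vec3 × Vec3)) ×
        (Vec3 × Vec3) => p.1.2 last := (measurable_pi_apply last).comp (by fun_prop)
    have hΨ : Measurable Ψ := by
      refine hΦ.comp (Measurable.prodMk (Measurable.prodMk (by fun_prop) ?_) hlast.snd)
      exact measurable_pi_lambda _ fun i => (measurable_pi_apply _).comp (by fun_prop)
    have hR : Measurable fun p => (p.1.2 last).1 * (Ψ p).1 * om n :=
      (hlast.fst.mul hΨ.fst).mul_const _
    have hS : Measurable fun p => (Ψ p).2 * om n := hΨ.snd.mul_const _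
    refine ⟨fun p => ((p.1.2 last).1 * (Ψ p).1 * om n,
      gain g k lam (rot ((Ψ p).2 * om n)
        (rot ((p.1.2 last).1 * (Ψ p).1 * om n)⁻¹ g + p.2.1 + p.2.2)) * ((Ψ p).2 * om n)),
      hR.prodMk ((measurable_gain.comp (continuous_rot.measurable.comp (hS.prodMk
        (((continuous_rot.measurable.comp (hR.inv.prodMk measurable_const)).add
          (by fun_prop)).add (by fun_prop))))).mul hS), fun r₀ s₀ w v nn => ?_⟩
    have h' : Ψ (((r₀, s₀), fun i => (w i, v i, nn i)), (v (n + 1), nn (n + 1)))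
        = (attitude r₀ w om n,
          estimate g k lam s₀ om (measurement g (attitude r₀ w om) v nn) n) :=
      (h r₀ s₀ w v nn).symm
    simp only [h']
    rfl

/-- The input cancels in the propagated error and remains only in the rotation acting on the output
noise. -/
theorem error_succ (r₀ s₀ : SO3) (w om : ℕ → SO3) (v nn : ℕ → Vec3) (n : ℕ) :
    error g k lam r₀ s₀ w om v nn (n + 1)
      = errorStep g k lam (error g k lam r₀ s₀ w om v nn n) (w n)
        (rot (estimate g k lam s₀ om (measurement g (attitude r₀ w om) v nn) n * om n)
          (v (n + 1) + nn (n + 1))) := by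
  simp only [error, errorStep, estimate, attitude]
  generalize estimate g k lam s₀ om (measurement g (attitude r₀ w om) v nn) n = S
  have h : rot (S * om n) (measurement g (attitude r₀ w om) v nn (n + 1))
      = rot (w n * (attitude r₀ w om n * S⁻¹))⁻¹ g
        + rot (S * om n) (v (n + 1) + nn (n + 1)) := by
    rw [measurement, add_assoc, rot_add, ← rot_mul]
    congr 2
    simp only [attitude]
    group
  rw [h]
  group

theorem measurable_errorStep :
    Measurable fun p : SO3 × SO3 × Vec3 => errorStep g k lam p.1 p.2.1 p.2.2 :=
  (measurable_correct (g := g) (k := k) (lam := lam)).comp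
    (f := fun p : SO3 × SO3 × Vec3 => (p.2.1 * p.1, p.2.2))
    (((measurable_fst.comp measurable_snd).mul measurable_fst).prodMk
      (measurable_snd.comp measurable_snd))

theorem measurable_errorStep_rot : Measurable fun p : (SO3 × SO3) × SO3 × Vec3 =>
    errorStep g k lam p.1.1 p.2.1 (rot p.1.2 p.2.2) := by
  have hr : Measurable fun p : (SO3 × SO3) × SO3 × Vec3 => rot p.1.2 p.2.2 :=
    (Continuous.rot (by fun_prop) (by fun_prop)).measurable
  exact measurable_errorStep.comp (f := fun p : (SO3 × SO3) × SO3 × Vec3 =>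
    (p.1.1, p.2.1, rot p.1.2 p.2.2))
    ((measurable_fst.comp measurable_fst).prodMk ((measurable_fst.comp measurable_snd).prodMk hr))

/-- Rotating an isotropic noise by an independent rotation does not change the error step. -/
theorem map_errorStep_rot {ν : Measure SO3} [IsProbabilityMeasure ν] {ρ : Measure Vec3}
    [IsProbabilityMeasure ρ] (hρ : IsIsotropic ρ) (μ : Measure (SO3 × SO3))
    [IsProbabilityMeasure μ] :
    (μ.prod (ν.prod ρ)).map (fun p => errorStep g k lam p.1.1 p.2.1 (rot p.1.2 p.2.2))
      = ((μ.map Prod.fst).prod (ν.prod ρ)).map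
        (fun p => errorStep g k lam p.1 p.2.1 p.2.2) := by
  have hm := measurable_errorStep_rot (g := g) (k := k) (lam := lam)
  refine Measure.ext fun A hA => ?_
  have hA' := measurable_errorStep (g := g) (k := k) (lam := lam) hA
  rw [Measure.map_apply hm hA, Measure.map_apply measurable_errorStep hA,
    Measure.prod_apply (hm hA), Measure.prod_apply hA',
    lintegral_map (measurable_measure_prodMk_left hA') measurable_fst]
  refine lintegral_congr fun z => ?_
  have hrot : Measurable (rot z.2) := (Continuous.rot continuous_const continuous_id).measurable
  -- With `z` frozen, the rotation is deterministic and isotropy absorbs it.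
  have hinv : (ν.prod ρ).map (Prod.map id (rot z.2)) = ν.prod ρ := by
    rw [← Measure.map_prod_map _ _ measurable_id hrot, Measure.map_id, hρ z.2]
  conv_rhs => rw [← hinv]
  rw [Measure.map_apply (measurable_id.prodMap hrot) (measurable_prodMk_left hA')]
  rfl

theorem bind_correct_mul_noise {ν : Measure SO3} [IsProbabilityMeasure ν] {ρ : Measure Vec3}
    [IsProbabilityMeasure ρ] (μ : Measure SO3) [IsProbabilityMeasure μ] :
    μ.bind (correctKernel g k lam ρ * noiseKernel ν : Kernel SO3 SO3)
      = (μ.prod (ν.prod ρ)).map (fun p => errorStep g k lam p.1 p.2.1 p.2.2) := by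
  have : IsProbabilityMeasure ((μ.prod ν).map fun p : SO3 × SO3 => p.2 * p.1) :=
    Measure.isProbabilityMeasure_map measurable_rightMul.aemeasurable
  rw [← Measure.bind_bind_kernel, bind_randomMap measurable_rightMul,
    bind_randomMap measurable_correct, ← Measure.prodAssoc_prod,
    Measure.map_map measurable_errorStep MeasurableEquiv.prodAssoc.measurable]
  conv_lhs => rw [← Measure.map_id (μ := ρ)]
  rw [Measure.map_prod_map _ _ measurable_rightMul measurable_id,
    Measure.map_map measurable_correct (measurable_rightMul.prodMap measurable_id)]
  rfl

theorem tendsto_tvDist_zero {X : Type*} [MeasurableSpace X] {μ : ℕ → Measure X} {π : Measure X}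
    {r : ℕ → ℝ} (hr : Tendsto r atTop (𝓝 0))
    (h : ∀ n A, MeasurableSet A → |(μ n).real A - π.real A| ≤ r n) :
    Tendsto (fun n => tvDist (μ n) π) atTop (𝓝 0) := by
  refine squeeze_zero (fun n => Real.iSup_nonneg fun _ => abs_nonneg _) (fun n => ?_) hr
  have : Nonempty {A : Set X // MeasurableSet A} := ⟨⟨∅, MeasurableSet.empty⟩⟩
  exact ciSup_le fun A => h n A.1 A.2

end ArtificialHorizon

theorem mainTheorem6 (g : Vec3) (hg : g ≠ 0) (k lam : ℝ) (hk : 0 < k) (hk1 : k ≤ 1)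
    (hlam : 0 < lam) (hlampi : lam ≤ Real.pi)
    (ν : Measure SO3) [IsProbabilityMeasure ν] (hν : ArtificialHorizon.IsDiffusive ν)
    (ρ : Measure Vec3) [IsProbabilityMeasure ρ] (hρ : ArtificialHorizon.IsIsotropic ρ) :
    ∃ π : Measure SO3, IsProbabilityMeasure π ∧
      ArtificialHorizon.IsStationary g k lam ν ρ π ∧
      ∀ (S : Type*) (mS : MeasurableSpace S) (P : Measure S) (_ : IsProbabilityMeasure P)
        (R₀ Rhat₀ : S → SO3) (W : ℕ → S → SO3) (V N : ℕ → S → Vec3) (Om : ℕ → SO3),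
        Measurable R₀ → Measurable Rhat₀ →
        (∀ n, Measurable (W n)) → (∀ n, Measurable (V n)) → (∀ n, Measurable (N n)) →
        (∀ n, P.map (W n) = ν) →
        (∀ n, P.map (fun s => V n s + N n s) = ρ) →
        iIndepFun (fun n s => (W n s, V n s, N n s)) P →
        (∀ n, IndepFun (W n) (fun s => (V n s, N n s)) P) →
        IndepFun (fun s => (R₀ s, Rhat₀ s)) (fun s n => (W n s, V n s, N n s)) P →
        Tendsto
          (fun n => ArtificialHorizon.tvDist
            (P.map (fun s => ArtificialHorizon.error g k lam (R₀ s) (Rhat₀ s)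
              (fun i => W i s) Om (fun i => V i s) (fun i => N i s) n)) π)
          atTop (𝓝 0) := by
  have hβ : IsMarkovKernel (ArtificialHorizon.correctKernel g k lam ρ) :=
    isMarkovKernel_randomMap ArtificialHorizon.measurable_correct ρ
  have hτ : IsMarkovKernel (ArtificialHorizon.noiseKernel ν) :=
    isMarkovKernel_randomMap ArtificialHorizon.measurable_rightMul ν
  let κ : Kernel SO3 SO3 :=
    ArtificialHorizon.correctKernel g k lam ρ * ArtificialHorizon.noiseKernel ν
  have hκ : IsMarkovKernel κ := inferInstanceAs (IsMarkovKernel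
    (ArtificialHorizon.correctKernel g k lam ρ ∘ₖ ArtificialHorizon.noiseKernel ν))
  obtain ⟨m, hm, ψ, hψ0, hψ⟩ := ArtificialHorizon.exists_minorant hg hk hk1 hlam hν hρ
  obtain ⟨π, hπ, hstat, r, hr, hconv⟩ := κ.exists_stationary_of_minorant hm ψ hψ0 hψ
  refine ⟨π, hπ, ?_, ?_⟩
  · rw [ArtificialHorizon.IsStationary, ← ArtificialHorizon.bind_correct_mul_noise]
    exact hstat
  intro S mS P hP R₀ Rhat₀ W V N Om hR₀ hRhat₀ hW hV hN hWν hVNρ hind hWVN hinit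
  let η : ℕ → S → SO3 := fun n s => ArtificialHorizon.error g k lam (R₀ s) (Rhat₀ s)
    (fun i => W i s) Om (fun i => V i s) (fun i => N i s) n
  have hlaw : ∀ n, Measurable (η n) ∧ P.map (η (n + 1)) = (P.map (η n)).bind κ := by
    intro n
    obtain ⟨Φ, hΦ, hstate⟩ := ArtificialHorizon.exists_measurable_state g k lam Om n
    -- The measurement at time `n` has already been used, but `W n` has not: it drives the next
    -- step.
    let past := fun s => (((R₀ s, Rhat₀ s), fun i : Finset.range n => (W i s, V i s, N i s)),
      (V n s, N n s))
    have hpast : Measurable past := by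
      refine Measurable.prodMk (Measurable.prodMk (hR₀.prodMk hRhat₀) ?_) ((hV n).prodMk (hN n))
      exact measurable_pi_lambda _ fun i => (hW i).prodMk ((hV i).prodMk (hN i))
    let F : SO3 × SO3 → SO3 × SO3 := fun p => (p.1 * p.2⁻¹, p.2 * Om n)
    have hF : Measurable F := by
      have : Continuous F := by fun_prop
      exact this.measurable
    -- The pair of the error `η n` and the predicted attitude `R̂'_{n+1}`, whose second component
    -- rotates the next output noise.
    let Z : S → SO3 × SO3 := fun s => F (Φ (past s))
    have hZ : Measurable Z := hF.comp (hΦ.comp hpast)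
    have hZ1 : ∀ s, (Z s).1 = η n s := fun s => by
      have := hstate (R₀ s) (Rhat₀ s) (fun i => W i s) (fun i => V i s) (fun i => N i s)
      simp only [Z, past, F, ← this]
      rfl
    have hη : Measurable (η n) := (funext hZ1 : (fun s => (Z s).1) = η n) ▸ hZ.fst
    let e : S → Vec3 := fun s => V (n + 1) s + N (n + 1) s
    have he : Measurable e := (hV _).add (hN _)
    have hWe : IndepFun (W n) e P :=
      (hind.indepFun (Nat.succ_ne_self n).symm).comp (φ := Prod.fst)
        (ψ := fun p : SO3 × Vec3 × Vec3 => p.2.1 + p.2.2) measurable_fst (by fun_prop)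
    have hZWe : IndepFun Z (fun s => (W n s, e s)) P :=
      (indepFun_history (hR₀.prodMk hRhat₀) hW (fun n => (hV n).prodMk (hN n)) hind hWVN hinit
        n).comp (φ := fun p => F (Φ p)) (ψ := fun p : SO3 × Vec3 × Vec3 => (p.1, p.2.1 + p.2.2))
        (hF.comp hΦ) (by fun_prop)
    rw [indepFun_iff_map_prod_eq_prod_map_map (by fun_prop) (by fun_prop)] at hWe hZWe
    rw [hWe, hWν n, hVNρ (n + 1)] at hZWe
    have hsucc : η (n + 1) = (fun p : (SO3 × SO3) × SO3 × Vec3 =>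
        ArtificialHorizon.errorStep g k lam p.1.1 p.2.1 (SO3.rot p.1.2 p.2.2)) ∘
          fun s => (Z s, W n s, e s) := by
      funext s
      have := hstate (R₀ s) (Rhat₀ s) (fun i => W i s) (fun i => V i s) (fun i => N i s)
      have h2 : (Z s).2 = ArtificialHorizon.estimate g k lam (Rhat₀ s) Om
          (ArtificialHorizon.measurement g (ArtificialHorizon.attitude (R₀ s) (fun i => W i s) Om)
            (fun i => V i s) (fun i => N i s)) n * Om n := by
        simp only [Z, past, F, ← this]
      simp only [Function.comp_apply, hZ1, h2]
      exact ArtificialHorizon.error_succ _ _ _ _ _ _ _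
    have hpZ : IsProbabilityMeasure (P.map Z) := Measure.isProbabilityMeasure_map hZ.aemeasurable
    have hpη : IsProbabilityMeasure (P.map (η n)) :=
      Measure.isProbabilityMeasure_map hη.aemeasurable
    refine ⟨hη, ?_⟩
    rw [ArtificialHorizon.bind_correct_mul_noise, hsucc,
      ← Measure.map_map ArtificialHorizon.measurable_errorStep_rot (by fun_prop), hZWe,
      ArtificialHorizon.map_errorStep_rot hρ, Measure.map_map measurable_fst hZ]
    congr 3
    exact funext hZ1
  have hp0 : IsProbabilityMeasure (P.map (η 0)) :=
    Measure.isProbabilityMeasure_map (hlaw 0).1.aemeasurable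
  have hpow : ∀ n, P.map (η n) = (P.map (η 0)).bind (κ ^ n : Kernel SO3 SO3) := by
    intro n
    induction n with
    | zero =>
      rw [pow_zero]
      exact Measure.id_comp.symm
    | succ n ih => rw [(hlaw n).2, ih, Measure.bind_bind_kernel, ← pow_succ']
  refine ArtificialHorizon.tendsto_tvDist_zero hr fun n A hA => ?_
  have := hconv (P.map (η 0)) hp0 n A hA
  rwa [← hpow n] at this
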